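/- Let $\mu,\nu>-1$, $\alpha\in\mathbb{R}$, $0<\theta<\pi$, and let $H_n(z)=H_n^{(\mu,\nu)}(z;\alpha,\theta)$, $n\ge 0$, be the polynomials given by $H_{-1}=0$, $H_0=1$ and $$\cos\theta\, H_n = \Bigl(z\sin\theta\Bigl[\bigl(n+\tfrac{\mu+\nu+1}{2}\bigr)^2+\alpha\Bigr]+\tfrac{\nu^2-\mu^2}{(2n+\mu+\nu)(2n+\mu+\nu+2)}\Bigr)H_n+\tfrac{2(n+\mu)(n+\nu)}{(2n+\mu+\nu)(2n+\mu+\nu+1)}H_{n-1}+\tfrac{2(n+1)(n+\mu+\nu+1)}{(2n+\mu+\nu+1)(2n+\mu+\nu+2)}H_{n+1}.$$ Put $$a_n^2=\frac{4n(n+\mu)(n+\nu)(n+\mu+\nu)}{\sin^2\theta\,\bigl[(n+\frac{\mu+\nu+1}{2})^2+\alpha\bigr]\bigl[(n+\frac{\mu+\nu-1}{2})^2+\alpha\bigr](2n+\mu+\nu+1)(2n+\mu+\nu)^2(2n+\mu+\nu-1)}\quad(n\ge1),$$ $$b_n=\frac{1}{\sin\theta\,\bigl[(n+\frac{\mu+\nu+1}{2})^2+\alpha\bigr]}\Bigl(\cos\theta+\frac{\mu^2-\nu^2}{(2n+\mu+\nu)(2n+\mu+\nu+2)}\Bigr)\quad(n\ge0).$$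 (In the coefficients with $n=0$ the common factors $\mu+\nu$ and $\mu+\nu+1$, and in $a_1^2$ the common factor $\mu+\nu+1$, are cancelled.) Then $a_n^2=\mathcal{O}(1/n^4)$ and $b_n=\mathcal{O}(1/n^2)$ as $n\to\infty$. Assume in addition that $\bigl(\frac{\mu+\nu+1}{2}\bigr)^2+\alpha>0$; equivalently, that $a_n^2$ is well defined and positive for all $n\ge1$. Let $a_n>0$ be the positive root of $a_n^2$. Then the Jacobi matrix $J$ with diagonal entries $b_0,b_1,\dots$ and off-diagonal entries $a_1,a_2,\dots$ defines a bounded operator on $\ell^2(\mathbb{N};\mathbb{C})$ which is compact and, moreover, trace class (that is, $\sum_i\langle e_i,|J|e_i\rangle<\infty$ for every orthonormal basis $(e_i)$, with $|J|=(J^*J)^{1/2}$). There are pairwise distinct real numbers $x_k\neq 0$, $k\in\mathbb{N}$, such that the spectrum of $J$ is $\{0\}\cup\{x_k : k\in\mathbb{N}\}$; the only accumulation point of the spectrum is $0$, $\lim_{k\to\infty}x_k=0$, and $\sum_{k}|x_k|<\infty$. There is exactly one probability measure $m$ on $\mathbb{R}$ with finite moments for which $\int H_iH_j\,dm=0$ for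 $i\ne j$ and $\int H_i^2\,dm>0$ for all $i$, and it is the discrete measure $m=\sum_k m(\{x_k\})\,\delta_{x_k}$, with $m(\{x_k\})>0$ for all $k$. -/

import Mathlib

open Filter Topology MeasureTheory Asymptotics
open scoped Polynomial ENNReal

noncomputable section

namespace FirstFamily

/-- The factor `(t + (μ+ν+1)/2)² + α` (used for `t = n` and `t = n - 1`). -/
def quad (μ ν α t : ℝ) : ℝ := (t + (μ + ν + 1) / 2) ^ 2 + α

/-- The coefficient `(ν²-μ²) / ((2n+μ+ν)(2n+μ+ν+2))`. For `n = 0` the common factor `μ+ν` is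
cancelled, so that the value is also the right one when `μ + ν = 0`. -/
def diagCoeff (μ ν : ℝ) (n : ℕ) : ℝ :=
  if n = 0 then (ν - μ) / (μ + ν + 2)
  else (ν ^ 2 - μ ^ 2) / ((2 * n + μ + ν) * (2 * n + μ + ν + 2))

/-- The coefficient of `H_{n-1}` in the recurrence (only used for `n ≥ 1`). -/
def downCoeff (μ ν : ℝ) (n : ℕ) : ℝ :=
  2 * (n + μ) * (n + ν) / ((2 * n + μ + ν) * (2 * n + μ + ν + 1))

/-- The coefficient `2(n+1)(n+μ+ν+1) / ((2n+μ+ν+1)(2n+μ+ν+2))` of `H_{n+1}` in the recurrence.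
For `n = 0` the common factor `μ+ν+1` is cancelled. -/
def upCoeff (μ ν : ℝ) (n : ℕ) : ℝ :=
  if n = 0 then 2 / (μ + ν + 2)
  else 2 * (n + 1) * (n + μ + ν + 1) / ((2 * n + μ + ν + 1) * (2 * n + μ + ν + 2))

/-- The polynomials `H_n(z)` of the first family, with `H_{-1} = 0`, `H_0 = 1` and
`cos θ H_n = (z sin θ [(n+(μ+ν+1)/2)²+α] + diagCoeff n) H_n + downCoeff n H_{n-1} + upCoeff n H_{n+1}`,
solved for `H_{n+1}`. -/
def H (μ ν α θ : ℝ) : ℕ → ℝ[X]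
  | 0 => 1
  | 1 =>
    Polynomial.C (upCoeff μ ν 0)⁻¹ *
      (Polynomial.C (Real.cos θ)
        - (Polynomial.X * Polynomial.C (Real.sin θ * quad μ ν α 0)
            + Polynomial.C (diagCoeff μ ν 0)))
  | n + 2 =>
    Polynomial.C (upCoeff μ ν (n + 1))⁻¹ *
      ((Polynomial.C (Real.cos θ)
        - (Polynomial.X * Polynomial.C (Real.sin θ * quad μ ν α ((n + 1 : ℕ) : ℝ))
            + Polynomial.C (diagCoeff μ ν (n + 1)))) * H μ ν α θ (n + 1)
        - Polynomial.C (downCoeff μ ν (n + 1)) * H μ ν α θ n)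

/-- The coefficient `a_n²` (for `n ≥ 1`) of the monic recurrence
`z P_n = P_{n+1} + b_n P_n + a_n² P_{n-1}`. For `n = 1` the common factor `μ+ν+1` is cancelled. -/
def aSq (μ ν α θ : ℝ) (n : ℕ) : ℝ :=
  if n = 1 then
    4 * (1 + μ) * (1 + ν) /
      (Real.sin θ ^ 2 * quad μ ν α 1 * quad μ ν α 0 * (μ + ν + 3) * (μ + ν + 2) ^ 2)
  else
    4 * n * (n + μ) * (n + ν) * (n + μ + ν) /
      (Real.sin θ ^ 2 * quad μ ν α n * quad μ ν α (n - 1) *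
        (2 * n + μ + ν + 1) * (2 * n + μ + ν) ^ 2 * (2 * n + μ + ν - 1))

/-- The coefficient `b_n` of the monic recurrence. -/
def b (μ ν α θ : ℝ) (n : ℕ) : ℝ :=
  1 / (Real.sin θ * quad μ ν α n) * (Real.cos θ - diagCoeff μ ν n)

/-- The off-diagonal entry `a_n = √(a_n²)` of the Jacobi matrix, `n ≥ 1`. -/
def a (μ ν α θ : ℝ) (n : ℕ) : ℝ := Real.sqrt (aSq μ ν α θ n)

/-- The infinite Jacobi matrix with diagonal `b_0, b_1, …` and off-diagonals `a_1, a_2, …`. -/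
def jacobiMatrix (μ ν α θ : ℝ) (i j : ℕ) : ℝ :=
  if i = j then b μ ν α θ i
  else if j = i + 1 then a μ ν α θ j
  else if i = j + 1 then a μ ν α θ i
  else 0

end FirstFamily

/-- The complex Hilbert space `ℓ²(ℕ)`. -/
abbrev EllTwo : Type := lp (fun _ : ℕ => ℂ) 2

/-- The bounded operator `T` on `ℓ²(ℕ)` has the matrix `A` in the standard basis. -/
def HasMatrix (T : EllTwo →L[ℂ] EllTwo) (A : ℕ → ℕ → ℝ) : Prop :=
  ∀ i j : ℕ, (T (lp.single 2 j (1 : ℂ)) : EllTwo) i = (A i j : ℂ)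

/-- A bounded operator `T` on a complex Hilbert space is trace class if
`∑ ⟪e_i, |T| e_i⟫ < ∞` for every orthonormal basis `(e_i)`, where `|T| = (T* T)^{1/2}`. -/
def IsTraceClass {E : Type} [NormedAddCommGroup E] [InnerProductSpace ℂ E] [CompleteSpace E]
    (T : E →L[ℂ] E) : Prop :=
  ∀ (ι : Type) (e : HilbertBasis ι ℂ E),
    Summable fun i : ι => (inner ℂ (e i) (CFC.abs T (e i))).re

/-- `m` is a (normalized) orthogonality measure on the real line for the sequence `p`. -/
structure IsOrthogonalityMeasure (p : ℕ → ℝ[X]) (m : Measure ℝ) : Prop where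
  isProbabilityMeasure : IsProbabilityMeasure m
  integrable_pow : ∀ k : ℕ, Integrable (fun x : ℝ => x ^ k) m
  integral_mul_eq_zero : ∀ i j : ℕ, i ≠ j → ∫ x, (p i).eval x * (p j).eval x ∂m = 0
  integral_sq_pos : ∀ i : ℕ, 0 < ∫ x, (p i).eval x ^ 2 ∂m

end

/-! The entries of J are O(1/n²), hence summable, so J is a norm-convergent series of self-adjoint
operators of finite rank: it is compact and self-adjoint, and by Bessel's inequality its diagonal in
any orthonormal system is absolutely summable. The three-term recurrence determines a formal
eigenvector from its 0-th coordinate, so all eigenvalues are simple. In an eigenbasis the diagonal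
consists of the eigenvalues, whence ∑|x_k| < ∞ and the trace class property.

The delicate point is that 0 is not an eigenvalue. Let D be the diagonal matrix with entries
`quad`^(-1/2). Then J = (sin θ)⁻¹ D (cos θ - B) D, where B is, up to alternating signs, the Jacobi
matrix of the Jacobi polynomials. A kernel vector would thus give a solution of the Jacobi
recurrence at cos θ, an interior point of (-1, 1). Such solutions oscillate without decaying fast: a
quadratic form E_n in two consecutive values is almost conserved, and n E_n is eventually
nondecreasing (`not_tendsto_of_elliptic_recurrence`). So the orthonormal polynomials at 0 do not
tend to 0 and are not square summable.

The measure m is the spectral measure of the first basis vector; its orthogonality relations are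
Parseval's identity in the eigenbasis. Orthogonality fixes all moments, and a measure with the
moments of a compactly supported one is compactly supported itself, so uniqueness follows from
Weierstrass approximation. -/

noncomputable section

/-! ### Jacobi operators with summable entries -/

namespace EllTwo

open InnerProductSpace

/-- The standard basis vectors of `ℓ²(ℕ)`. -/
def e (n : ℕ) : EllTwo := lp.single 2 n (1 : ℂ)

lemma inner_e_left (n : ℕ) (f : EllTwo) : inner ℂ (e n) f = f n := by
  simp [e, lp.inner_single_left]

lemma inner_e_right (n : ℕ) (f : EllTwo) : inner ℂ f (e n) = star (f n) := by
  simp [e, lp.inner_single_right]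

lemma norm_e (n : ℕ) : ‖e n‖ = 1 := by
  simp [e, lp.norm_single]

lemma e_apply (n k : ℕ) : (e n : EllTwo) k = if k = n then 1 else 0 := by
  simp [e, lp.single_apply, Pi.single_apply]

lemma orthonormal_e : Orthonormal ℂ e := by
  rw [orthonormal_iff_ite]
  intro i j
  rw [inner_e_left, e_apply]

/-- The `n`-th summand of a tridiagonal operator. -/
def tridiagTerm (A b : ℕ → ℝ) (n : ℕ) : EllTwo →L[ℂ] EllTwo :=
  (b n : ℂ) • rankOne ℂ (e n) (e n)
    + (A n : ℂ) • (rankOne ℂ (e n) (e (n + 1)) + rankOne ℂ (e (n + 1)) (e n))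

/-- The Jacobi operator with diagonal `b 0, b 1, …` and off-diagonal `A 0, A 1, …`. -/
def tridiag (A b : ℕ → ℝ) : EllTwo →L[ℂ] EllTwo := ∑' n, tridiagTerm A b n

lemma norm_tridiagTerm_le (A b : ℕ → ℝ) (n : ℕ) :
    ‖tridiagTerm A b n‖ ≤ |b n| + 2 * |A n| := by
  refine (norm_add_le _ _).trans ?_
  rw [norm_smul, norm_smul, norm_rankOne, norm_e]
  have h : ‖rankOne ℂ (e n) (e (n + 1)) + rankOne ℂ (e (n + 1)) (e n)‖ ≤ 2 := by
    refine (norm_add_le _ _).trans ?_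
    rw [norm_rankOne, norm_rankOne, norm_e, norm_e]
    norm_num
  simp only [Complex.norm_real, Real.norm_eq_abs]
  nlinarith [abs_nonneg (A n)]

variable {A b : ℕ → ℝ}

lemma hasSum_tridiag (hA : Summable fun n => |A n|) (hb : Summable fun n => |b n|) :
    HasSum (tridiagTerm A b) (tridiag A b) :=
  (Summable.of_norm_bounded (hb.add (hA.mul_left 2)) (norm_tridiagTerm_le A b)).hasSum

lemma hasSum_tridiag_apply (hA : Summable fun n => |A n|) (hb : Summable fun n => |b n|)
    (f : EllTwo) : HasSum (fun n => tridiagTerm A b n f) (tridiag A b f) :=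
  (hasSum_tridiag hA hb).mapL (ContinuousLinearMap.apply ℂ EllTwo f)

lemma inner_tridiagTerm (f g : EllTwo) (n : ℕ) :
    inner ℂ g (tridiagTerm A b n f) =
      b n * (star (g n) * f n) + A n * (star (g n) * f (n + 1) + star (g (n + 1)) * f n) := by
  simp only [tridiagTerm, add_apply, smul_apply,
    rankOne_apply, inner_add_right, inner_smul_right, inner_e_left, inner_e_right]
  ring

lemma hasSum_inner_tridiag (hA : Summable fun n => |A n|) (hb : Summable fun n => |b n|)
    (f g : EllTwo) :
    HasSum (fun n => b n * (star (g n) * f n)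
      + A n * (star (g n) * f (n + 1) + star (g (n + 1)) * f n)) (inner ℂ g (tridiag A b f)) := by
  simpa only [inner_tridiagTerm, innerSL_apply_apply] using
    (hasSum_tridiag_apply hA hb f).mapL (innerSL ℂ g)

lemma tridiag_apply_zero (hA : Summable fun n => |A n|) (hb : Summable fun n => |b n|)
    (f : EllTwo) : (tridiag A b f : EllTwo) 0 = b 0 * f 0 + A 0 * f 1 := by
  rw [← inner_e_left, ← (hasSum_inner_tridiag hA hb f (e 0)).tsum_eq,
    tsum_eq_single 0 (by intro n hn; simp [e_apply, hn])]
  simp [e_apply]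

lemma tridiag_apply_succ (hA : Summable fun n => |A n|) (hb : Summable fun n => |b n|)
    (f : EllTwo) (k : ℕ) : (tridiag A b f : EllTwo) (k + 1) =
      b (k + 1) * f (k + 1) + A (k + 1) * f (k + 2) + A k * f k := by
  rw [← inner_e_left, ← (hasSum_inner_tridiag hA hb f (e (k + 1))).tsum_eq,
    tsum_eq_sum (s := {k, k + 1}) (by
      intro n hn
      simp only [Finset.mem_insert, Finset.mem_singleton, not_or] at hn
      simp [e_apply, hn.1, hn.2]), Finset.sum_pair (by simp)]
  simp [e_apply]
  ring

/-- Adjoints commute with `tsum` unconditionally; a divergent series has the value 0, which is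
self-adjoint too. -/
lemma isSelfAdjoint_tridiag : IsSelfAdjoint (tridiag A b) := by
  unfold IsSelfAdjoint tridiag
  rw [tsum_star]
  congr 1
  ext1 n
  rw [tridiagTerm, star_add, star_smul, star_smul, star_add]
  simp only [ContinuousLinearMap.star_eq_adjoint, adjoint_rankOne, Complex.star_def,
    Complex.conj_ofReal]
  rw [add_comm (rankOne ℂ (e (n + 1)) (e n))]

lemma isCompactOperator_rankOne (f g : EllTwo) : IsCompactOperator (rankOne ℂ f g) := by
  rw [rankOne_def']
  exact (isCompactOperator_id (E := ℂ)).clm_comp (ContinuousLinearMap.toSpanSingleton ℂ f)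
    |>.comp_clm (innerSL ℂ g)

/-- The partial sums have finite rank and converge in norm. -/
lemma isCompactOperator_tridiag (hA : Summable fun n => |A n|) (hb : Summable fun n => |b n|) :
    IsCompactOperator (tridiag A b) := by
  refine isCompactOperator_of_tendsto (hasSum_tridiag hA hb) (Eventually.of_forall fun s => ?_)
  exact (compactOperator (RingHom.id ℂ) EllTwo EllTwo).sum_mem (f := tridiagTerm A b) fun n _ =>
    ((isCompactOperator_rankOne _ _).smul _).add
      (((isCompactOperator_rankOne _ _).add (isCompactOperator_rankOne _ _)).smul _)

lemma norm_inner_tridiagTerm_le (f : EllTwo) (n : ℕ) :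
    ‖inner ℂ f (tridiagTerm A b n f)‖ ≤
      |b n| * ‖f n‖ ^ 2 + |A n| * (‖f n‖ ^ 2 + ‖f (n + 1)‖ ^ 2) := by
  rw [inner_tridiagTerm]
  refine (norm_add_le _ _).trans ?_
  have h : ‖star (f n) * f (n + 1) + star (f (n + 1)) * f n‖ ≤ ‖f n‖ ^ 2 + ‖f (n + 1)‖ ^ 2 := by
    refine (norm_add_le _ _).trans ?_
    simp only [norm_mul, norm_star]
    nlinarith [sq_nonneg (‖f n‖ - ‖f (n + 1)‖)]
  simp only [norm_mul, norm_star, Complex.norm_real, Real.norm_eq_abs]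
  gcongr
  exact (sq _).ge

lemma sum_norm_apply_sq_le {ι : Type*} {v : ι → EllTwo} (hv : Orthonormal ℂ v) (s : Finset ι)
    (n : ℕ) : ∑ i ∈ s, ‖v i n‖ ^ 2 ≤ 1 := by
  simpa [inner_e_right, norm_e] using hv.sum_inner_products_le (s := s) (e n)

/-- The diagonal of a summable Jacobi operator is absolutely summable in any orthonormal system. -/
lemma summable_norm_inner_tridiag (hA : Summable fun n => |A n|) (hb : Summable fun n => |b n|)
    {ι : Type*} {v : ι → EllTwo} (hv : Orthonormal ℂ v) :
    Summable fun i => ‖inner ℂ (v i) (tridiag A b (v i))‖ := by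
  have hsum : Summable fun n => |b n| + 2 * |A n| := hb.add (hA.mul_left 2)
  set g : ι → ℕ → ℝ := fun i n =>
    |b n| * ‖v i n‖ ^ 2 + |A n| * (‖v i n‖ ^ 2 + ‖v i (n + 1)‖ ^ 2)
  have hg0 : ∀ i n, 0 ≤ g i n := fun i n => by positivity
  -- Bessel's inequality for `e n` and `e (n + 1)` gives a bound independent of `s`; the final
  -- exchange of sums rests on it.
  have hgs : ∀ s : Finset ι, ∀ n, ∑ i ∈ s, g i n ≤ |b n| + 2 * |A n| := by
    intro s n
    have h1 := sum_norm_apply_sq_le hv s n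
    have h2 := sum_norm_apply_sq_le hv s (n + 1)
    simp only [g, Finset.sum_add_distrib, ← Finset.mul_sum]
    nlinarith [abs_nonneg (A n), abs_nonneg (b n)]
  have hgsum : ∀ i, Summable (g i) := fun i =>
    Summable.of_nonneg_of_le (hg0 i) (fun n => by simpa using hgs {i} n) hsum
  have hle : ∀ i, ‖inner ℂ (v i) (tridiag A b (v i))‖ ≤ ∑' n, g i n := by
    intro i
    rw [← (hasSum_inner_tridiag hA hb (v i) (v i)).tsum_eq]
    refine tsum_of_norm_bounded (hgsum i).hasSum fun n => ?_
    rw [← inner_tridiagTerm]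
    exact norm_inner_tridiagTerm_le (v i) n
  refine summable_of_sum_le (c := ∑' n, (|b n| + 2 * |A n|)) (fun _ => norm_nonneg _) fun s => ?_
  calc ∑ i ∈ s, ‖inner ℂ (v i) (tridiag A b (v i))‖
      ≤ ∑ i ∈ s, ∑' n, g i n := Finset.sum_le_sum fun i _ => hle i
    _ = ∑' n, ∑ i ∈ s, g i n := (Summable.tsum_finsetSum fun i _ => hgsum i).symm
    _ ≤ _ := Summable.tsum_le_tsum (hgs s) (summable_sum fun i _ => hgsum i) hsum

end EllTwo

/-! ### Trace class from a summable eigenbasis -/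

lemma hasSum_norm_inner_sq {ι E : Type*} [NormedAddCommGroup E]
    [InnerProductSpace ℂ E] (u : HilbertBasis ι ℂ E) (f : E) :
    HasSum (fun i => ‖inner ℂ (u i) f‖ ^ 2) (‖f‖ ^ 2) := by
  have h := u.hasSum_inner_mul_inner f f
  rw [inner_self_eq_norm_sq_to_K] at h
  have h2 : ∀ i, inner ℂ f (u i) * inner ℂ (u i) f = ((‖inner ℂ (u i) f‖ ^ 2 : ℝ) : ℂ) := by
    intro i
    rw [← inner_conj_symm f (u i), mul_comm, Complex.mul_conj, Complex.normSq_eq_norm_sq]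
  simp_rw [h2] at h
  exact Complex.hasSum_ofReal.mp (by simpa using h)

section TraceClass

variable {E : Type} [NormedAddCommGroup E] [InnerProductSpace ℂ E] [CompleteSpace E]
  {T : E →L[ℂ] E} {x : ℕ → ℝ} {v : HilbertBasis ℕ ℂ E}

/-- With S = |T|, S² f = T² f = |l|² f, so w = S f - |l| f satisfies S w = -|l| w. Positivity of S
forces w = 0. -/
lemma abs_apply_eigenvector (hs : IsSelfAdjoint T) {f : E} {l : ℝ} (hl : l ≠ 0)
    (hf : T f = (l : ℂ) • f) : CFC.abs T f = ((|l| : ℝ) : ℂ) • f := by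
  set S := CFC.abs T
  have hSpos : S.IsPositive := (ContinuousLinearMap.nonneg_iff_isPositive S).mp (CFC.abs_nonneg T)
  have hSS : S (S f) = ((|l| : ℝ) : ℂ) • ((|l| : ℝ) : ℂ) • f := by
    have h : S (S f) = T (T f) := by
      change (S * S) f = (T * T) f
      rw [CFC.abs_mul_abs, hs.star_eq]
    rw [h, hf, map_smul, hf, smul_smul, smul_smul]
    norm_cast
    rw [abs_mul_abs_self]
  set w := S f - ((|l| : ℝ) : ℂ) • f with hw
  have hSw : S w = -(((|l| : ℝ) : ℂ) • w) := by
    rw [hw, map_sub, map_smul, hSS, smul_sub]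
    abel
  have h1 := hSpos.re_inner_nonneg_right w
  rw [hSw, inner_neg_right, inner_smul_right, inner_self_eq_norm_sq_to_K] at h1
  have h2 : 0 ≤ -(|l| * ‖w‖ ^ 2) := by
    have h : ∀ r t : ℝ, (-((r : ℂ) * (t : ℂ) ^ 2)).re = -(r * t ^ 2) := fun r t => by norm_cast
    exact h1.trans_eq (h _ _)
  have h3 : 0 < |l| := abs_pos.mpr hl
  have h4 : ‖w‖ ^ 2 = 0 := by nlinarith [sq_nonneg ‖w‖]
  exact sub_eq_zero.mp (norm_eq_zero.mp ((pow_eq_zero_iff two_ne_zero).mp h4))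

/-- Tonelli for the nonnegative double series of |x_k| |⟨u_i, v_k⟩|²: summing over i first gives
|x_k| by Parseval, summing over k first gives ⟨u_i, |T| u_i⟩. -/
lemma isTraceClass_of_eigenbasis (hs : IsSelfAdjoint T) (hne : ∀ k, x k ≠ 0)
    (hv : ∀ k, T (v k) = (x k : ℂ) • v k) (hx : Summable fun k => |x k|) :
    IsTraceClass T := by
  intro ι u
  have hsymm : ∀ f g : E, inner ℂ (CFC.abs T f) g = inner ℂ f (CFC.abs T g) :=
    ((ContinuousLinearMap.nonneg_iff_isPositive _).mp (CFC.abs_nonneg T)).isSymmetric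
  have hterm : ∀ i, HasSum (fun k => |x k| * ‖inner ℂ (u i) (v k)‖ ^ 2)
      (inner ℂ (u i) (CFC.abs T (u i))).re := by
    intro i
    have h := Complex.hasSum_re (v.hasSum_inner_mul_inner (u i) (CFC.abs T (u i)))
    convert h using 2 with k
    rw [← hsymm, abs_apply_eigenvector hs (hne k) (hv k), inner_smul_left, Complex.conj_ofReal,
      ← inner_conj_symm (v k) (u i), mul_left_comm, Complex.mul_conj, Complex.normSq_eq_norm_sq]
    norm_cast
  have hprod : Summable fun p : ℕ × ι => |x p.1| * ‖inner ℂ (u p.2) (v p.1)‖ ^ 2 := by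
    refine (summable_prod_of_nonneg fun p => by positivity).mpr ⟨fun k => ?_, ?_⟩
    · exact (hasSum_norm_inner_sq u (v k)).summable.mul_left |x k|
    · refine hx.congr fun k => ?_
      simp only
      rw [tsum_mul_left, (hasSum_norm_inner_sq u (v k)).tsum_eq, v.orthonormal.1]
      simp
  refine hprod.prod_symm.prod.congr fun i => ?_
  exact (hterm i).tsum_eq

end TraceClass

/-! ### Eigenbasis and spectrum of a compact operator with simple eigenvalues -/

namespace EllTwo

open InnerProductSpace Module.End

variable {T : EllTwo →L[ℂ] EllTwo}

/-- A compact injective symmetric operator on `ℓ²(ℕ)` with absolutely summable diagonals, none of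
whose eigenvectors has vanishing `0`-th coordinate, has simple eigenvalues `x k` and an orthonormal
basis of eigenvectors indexed by `ℕ`. -/
lemma exists_hilbertBasis_eigenvectors (hc : IsCompactOperator T)
    (hs : (T : EllTwo →ₗ[ℂ] EllTwo).IsSymmetric) (hinj : ∀ f, T f = 0 → f = 0)
    (h0 : ∀ (l : ℂ) (f : EllTwo), T f = l • f → f 0 = 0 → f = 0)
    (htr : ∀ (ι : Type) (v : ι → EllTwo), Orthonormal ℂ v →
      Summable fun i => ‖inner ℂ (v i) (T (v i))‖) :
    ∃ (x : ℕ → ℝ) (v : HilbertBasis ℕ ℂ EllTwo), Function.Injective x ∧ (∀ k, x k ≠ 0) ∧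
      (∀ k, T (v k) = (x k : ℂ) • v k) ∧
      ∀ l : ℂ, HasEigenvalue (T : Module.End ℂ EllTwo) l → ∃ k, l = x k := by
  let Λ := {l : ℝ // ∃ f : EllTwo, ‖f‖ = 1 ∧ T f = (l : ℂ) • f}
  choose g hg1 hgT using fun l : Λ => l.2
  have hgne : ∀ l, g l ≠ 0 := fun l h => by simpa [h] using hg1 l
  have hort : Orthonormal ℂ g := by
    refine ⟨hg1, fun i j hij => ?_⟩
    have h1 := hs (g i) (g j)
    simp only [ContinuousLinearMap.coe_coe, hgT, inner_smul_left, inner_smul_right,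
      Complex.conj_ofReal] at h1
    rw [← sub_eq_zero, ← sub_mul, mul_eq_zero, sub_eq_zero, Complex.ofReal_inj] at h1
    exact h1.resolve_left fun h => hij (Subtype.ext h)
  have hev : ∀ l : ℂ, HasEigenvalue (T : Module.End ℂ EllTwo) l → ∃ k : Λ, l = (k : ℝ) := by
    intro l hl
    have hre : ((l.re : ℝ) : ℂ) = l := Complex.conj_eq_iff_re.mp (hs.conj_eigenvalue_eq_self hl)
    obtain ⟨f, hf⟩ := hl.exists_hasEigenvector
    have hTf : T f = l • f := hf.apply_eq_smul
    have hn : (‖f‖ : ℂ) ≠ 0 := by simpa using hf.2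
    refine ⟨⟨l.re, (‖f‖⁻¹ : ℂ) • f, ?_, ?_⟩, hre.symm⟩
    · rw [norm_smul, norm_inv, Complex.norm_real, norm_norm, inv_mul_cancel₀ (by simpa using hf.2)]
    · rw [map_smul, hTf, hre, smul_comm]
  -- The eigenspaces of a compact symmetric operator are total, and each is a line: subtracting the
  -- multiple of `g k` with the same 0-th coordinate leaves an eigenvector killed by `h0`.
  have htot : (Submodule.span ℂ (Set.range g))ᗮ = ⊥ := by
    rw [eq_bot_iff, ← ContinuousLinearMap.orthogonalComplement_iSup_eigenspaces_eq_bot hc hs]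
    refine Submodule.orthogonal_le (iSup_le fun l f hf => ?_)
    rw [mem_eigenspace_iff] at hf
    by_cases hf0 : f = 0
    · rw [hf0]; exact Submodule.zero_mem _
    obtain ⟨k, hk⟩ := hev l (hasEigenvalue_of_hasEigenvector ⟨mem_eigenspace_iff.mpr hf, hf0⟩)
    have hgk : g k 0 ≠ 0 := fun h => hgne k (h0 _ _ (hgT k) h)
    have hfk : f = (f 0 / g k 0) • g k := by
      rw [← sub_eq_zero]
      refine h0 l _ ?_ ?_
      · have hf' : T f = l • f := hf
        rw [map_sub, map_smul, hf', hgT, ← hk, smul_sub, smul_comm]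
      · change f 0 - (f 0 / g k 0) * g k 0 = 0
        rw [div_mul_cancel₀ _ hgk, sub_self]
    rw [hfk]
    exact Submodule.smul_mem _ _ (Submodule.subset_span ⟨k, rfl⟩)
  have hne : ∀ l : Λ, (l : ℝ) ≠ 0 := fun l h =>
    hgne l (hinj _ (by rw [hgT, h, Complex.ofReal_zero, zero_smul]))
  -- The diagonal entries in the system `g` are the eigenvalues, all nonzero, and a summable family
  -- has countable support.
  have hcount : Countable Λ := by
    have h := (htr Λ g hort).countable_support
    have hu : (Function.support fun i => ‖inner ℂ (g i) (T (g i))‖) = Set.univ := by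
      ext l
      simp [hgT, hne, hgne]
    rwa [hu, Set.countable_univ_iff] at h
  have hinf : Infinite Λ := by
    by_contra hfin
    rw [not_infinite_iff_finite] at hfin
    have : FiniteDimensional ℂ (Submodule.span ℂ (Set.range g)) :=
      FiniteDimensional.span_of_finite ℂ (Set.finite_range g)
    rw [Submodule.orthogonal_eq_bot_iff] at htot
    rw [htot] at this
    have h2 : FiniteDimensional ℂ EllTwo := Module.Finite.of_surjective
      (Submodule.topEquiv : (⊤ : Submodule ℂ EllTwo) ≃ₗ[ℂ] EllTwo).toLinearMap
      Submodule.topEquiv.surjective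
    have h3 := orthonormal_e.linearIndependent.finite
    exact not_finite ℕ
  obtain ⟨q⟩ : Nonempty (ℕ ≃ Λ) := nonempty_equiv_of_countable
  refine ⟨fun k => q k, HilbertBasis.mkOfOrthogonalEqBot (hort.comp q q.injective) ?_,
    Subtype.val_injective.comp q.injective, fun k => hne _, fun k => ?_, fun l hl => ?_⟩
  · rwa [q.surjective.range_comp]
  · simpa using hgT (q k)
  · obtain ⟨k, hk⟩ := hev l hl
    exact ⟨q.symm k, by simpa using hk⟩

variable {x : ℕ → ℝ} {v : HilbertBasis ℕ ℂ EllTwo}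

lemma inner_eigenvector (hv : ∀ k, T (v k) = (x k : ℂ) • v k) (k : ℕ) :
    inner ℂ (v k) (T (v k)) = (x k : ℂ) := by
  rw [hv, inner_smul_right, inner_self_eq_norm_sq_to_K, v.orthonormal.1]
  simp

lemma hasEigenvalue_of_eigenbasis (hv : ∀ k, T (v k) = (x k : ℂ) • v k) (k : ℕ) :
    HasEigenvalue (T : Module.End ℂ EllTwo) (x k : ℂ) :=
  hasEigenvalue_of_hasEigenvector ⟨mem_eigenspace_iff.mpr (hv k), v.orthonormal.ne_zero k⟩

/-- Nonzero spectral values of a compact operator are eigenvalues, and 0 is a limit of the `x k` in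
the closed spectrum. -/
lemma spectrum_eq_of_eigenbasis (hc : IsCompactOperator T) (hne : ∀ k, x k ≠ 0)
    (hv : ∀ k, T (v k) = (x k : ℂ) • v k)
    (hev : ∀ l : ℂ, HasEigenvalue (T : Module.End ℂ EllTwo) l → ∃ k, l = x k)
    (hx : Tendsto x atTop (𝓝 0)) :
    spectrum ℂ T = insert 0 (Set.range fun k => (x k : ℂ)) := by
  have hmem : ∀ k, (x k : ℂ) ∈ spectrum ℂ T := fun k =>
    (hc.hasEigenvalue_iff_mem_spectrum (by simpa using hne k)).mp (hasEigenvalue_of_eigenbasis hv k)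
  ext z
  constructor
  · intro hz
    by_cases h : z = 0
    · exact Or.inl h
    · obtain ⟨k, hk⟩ := hev z ((hc.hasEigenvalue_iff_mem_spectrum h).mpr hz)
      exact Or.inr ⟨k, hk.symm⟩
  · rintro (rfl | ⟨k, rfl⟩)
    · refine (spectrum.isClosed T).mem_of_tendsto (f := fun k => (x k : ℂ)) (b := atTop) ?_
        (Eventually.of_forall hmem)
      simpa [Function.comp_def] using (Complex.continuous_ofReal.tendsto 0).comp hx
    · exact hmem k

lemma accPt_insert_range (hne : ∀ k, x k ≠ 0) (hx : Tendsto x atTop (𝓝 0)) :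
    {z : ℂ | AccPt z (𝓟 (insert 0 (Set.range fun k => (x k : ℂ))))} = {0} := by
  have hxc : Tendsto (fun k => (x k : ℂ)) atTop (𝓝 0) := by
    simpa [Function.comp_def] using (Complex.continuous_ofReal.tendsto 0).comp hx
  ext z
  simp only [Set.mem_ofPred_eq, Set.mem_singleton_iff]
  constructor
  · intro hz
    by_contra hz0
    have hpos : 0 < ‖z‖ / 2 := by positivity
    rw [accPt_iff_nhds] at hz
    have hfin : {k | ¬ dist (x k : ℂ) 0 < ‖z‖ / 2}.Finite := by
      rw [← Nat.cofinite_eq_atTop] at hxc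
      exact (Metric.tendsto_nhds.mp hxc) _ hpos
    -- The finitely many `x k` of modulus at least ‖z‖/2, with z itself removed, form a closed set
    -- missing z.
    have hF := (hfin.image fun k => (x k : ℂ)).subset (Set.sdiff_subset (t := {z}))
    obtain ⟨y, ⟨⟨hy1, hy2⟩, hy3⟩, hyz⟩ := hz _ (inter_mem
      (hF.isClosed.isOpen_compl.mem_nhds fun h => h.2 rfl) (Metric.ball_mem_nhds z hpos))
    have hylarge : ‖z‖ / 2 < ‖y‖ := by
      rw [Metric.mem_ball, dist_eq_norm] at hy2
      have := norm_sub_norm_le z y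
      rw [norm_sub_rev] at this
      linarith
    obtain rfl | ⟨k, rfl⟩ := hy3
    · simp at hylarge
      linarith
    · exact hy1 ⟨⟨k, by simpa using hylarge.le, rfl⟩, hyz⟩
  · rintro rfl
    rw [accPt_iff_nhds]
    intro U hU
    obtain ⟨k, hk⟩ := (hxc.eventually_mem hU).exists
    exact ⟨x k, ⟨hk, Or.inr ⟨k, rfl⟩⟩, by simpa using hne k⟩

end EllTwo

/-! ### Uniqueness of the orthogonality measure -/

section Determinacy

lemma integrable_eval_of_integrable_pow {m : Measure ℝ}
    (hm : ∀ k : ℕ, Integrable (fun x : ℝ => x ^ k) m) (q : ℝ[X]) :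
    Integrable (fun x => q.eval x) m := by
  simp only [Polynomial.eval_eq_sum_range]
  exact integrable_finsetSum _ fun k _ => (hm k).const_mul _

/-- Two orthogonality measures of a sequence of polynomials, the `n`-th of degree `n`, have the same
moments. -/
lemma integral_eval_eq_of_isOrthogonalityMeasure {p : ℕ → ℝ[X]} (hp0 : p 0 = 1)
    (hdeg : ∀ n, (p n).degree = n) {m m' : Measure ℝ} (hm : IsOrthogonalityMeasure p m)
    (hm' : IsOrthogonalityMeasure p m') (q : ℝ[X]) :
    ∫ x, q.eval x ∂m = ∫ x, q.eval x ∂m' := by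
  have := hm.isProbabilityMeasure
  have := hm'.isProbabilityMeasure
  have hspan : Submodule.span ℝ (Set.range p) = ⊤ :=
    Polynomial.Sequence.span ⟨p, hdeg⟩ fun i => isUnit_iff_ne_zero.mpr <| by
      rw [Polynomial.leadingCoeff_ne_zero]
      intro h
      have := hdeg i
      change p i = 0 at h
      simp [h] at this
  have hq : q ∈ Submodule.span ℝ (Set.range p) := hspan ▸ Submodule.mem_top
  induction hq using Submodule.span_induction with
  | mem q hq =>
    obtain ⟨i, rfl⟩ := hq
    -- Since p_0 = 1, the integral of p_i is the total mass for i = 0 and an orthogonality relation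
    -- otherwise.
    rcases eq_or_ne i 0 with rfl | hi
    · simp [hp0]
    · simpa [hp0] using (hm.integral_mul_eq_zero i 0 hi).trans
        (hm'.integral_mul_eq_zero i 0 hi).symm
  | zero => simp
  | add q r _ _ hq hr =>
    simp only [Polynomial.eval_add]
    rw [integral_add, integral_add, hq, hr] <;>
      first
        | exact integrable_eval_of_integrable_pow hm.integrable_pow _
        | exact integrable_eval_of_integrable_pow hm'.integrable_pow _
  | smul a q _ hq =>
    simp only [Polynomial.eval_smul, smul_eq_mul]
    rw [integral_const_mul, integral_const_mul, hq]

/-- A probability measure whose even moments are dominated by `R ^ (2 n)` lives on `[-S, S]` for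
every `S > R`. -/
lemma ae_abs_le_of_moments_le {m : Measure ℝ} [IsProbabilityMeasure m]
    (hm : ∀ k : ℕ, Integrable (fun x : ℝ => x ^ k) m) {R S : ℝ} (hR : 0 ≤ R) (hRS : R < S)
    (hmom : ∀ n : ℕ, ∫ x, x ^ (2 * n) ∂m ≤ R ^ (2 * n)) : ∀ᵐ x ∂m, |x| ≤ S := by
  have hS : 0 < S := hR.trans_lt hRS
  -- Markov's inequality for the 2n-th moment; the bound tends to 0 with n.
  have hle : ∀ n : ℕ, m.real {x | S < |x|} ≤ ((R / S) ^ 2) ^ n := by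
    intro n
    have h1 := mul_meas_ge_le_integral_of_nonneg (μ := m) (f := fun x : ℝ => x ^ (2 * n))
      (Eventually.of_forall fun x => by simp only [pow_mul]; positivity) (hm _) (S ^ (2 * n))
    have h2 : m.real {x | S < |x|} ≤ m.real {x : ℝ | S ^ (2 * n) ≤ x ^ (2 * n)} := by
      refine measureReal_mono fun x hx => ?_
      have hx' : S < |x| := hx
      change S ^ (2 * n) ≤ x ^ (2 * n)
      rw [← (even_two_mul n).pow_abs x]
      gcongr
    rw [← pow_mul, div_pow, le_div_iff₀ (by positivity), mul_comm]
    calc S ^ (2 * n) * m.real {x | S < |x|}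
        ≤ S ^ (2 * n) * m.real {x : ℝ | S ^ (2 * n) ≤ x ^ (2 * n)} := by gcongr
      _ ≤ _ := h1.trans (hmom n)
  have hlt : (R / S) ^ 2 < 1 := by
    rw [sq_lt_one_iff₀ (by positivity), div_lt_one hS]
    exact hRS
  have h0 : m.real {x | S < |x|} ≤ 0 :=
    ge_of_tendsto' (tendsto_pow_atTop_nhds_zero_of_lt_one (sq_nonneg _) hlt) hle
  rw [ae_iff]
  simp only [not_le]
  exact (measureReal_eq_zero_iff).mp (le_antisymm h0 measureReal_nonneg)

/-- Probability measures on a compact interval are determined by their moments. -/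
lemma measure_eq_of_integral_eval_eq {m m' : Measure ℝ} [IsProbabilityMeasure m]
    [IsProbabilityMeasure m'] {S : ℝ} (hm : ∀ᵐ x ∂m, |x| ≤ S) (hm' : ∀ᵐ x ∂m', |x| ≤ S)
    (hint : ∀ q : ℝ[X], Integrable (fun x => q.eval x) m)
    (hint' : ∀ q : ℝ[X], Integrable (fun x => q.eval x) m')
    (h : ∀ q : ℝ[X], ∫ x, q.eval x ∂m = ∫ x, q.eval x ∂m') : m = m' := by
  refine ext_of_forall_integral_eq_of_IsFiniteMeasure fun f => ?_
  refine eq_of_forall_dist_le fun ε hε => ?_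
  obtain ⟨q, hq⟩ := exists_polynomial_near_of_continuousOn (-S) S f f.continuous.continuousOn
    (ε / 2) (half_pos hε)
  have key : ∀ n : Measure ℝ, IsProbabilityMeasure n → (∀ᵐ x ∂n, |x| ≤ S) →
      Integrable (fun x => q.eval x) n → |∫ x, f x ∂n - ∫ x, q.eval x ∂n| ≤ ε / 2 := by
    intro n _ hn hqn
    have hb : ∀ᵐ x ∂n, ‖f x - q.eval x‖ ≤ ε / 2 := by
      filter_upwards [hn] with x hx
      rw [Real.norm_eq_abs, abs_sub_comm]
      exact (hq x (abs_le.mp hx)).le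
    have h := norm_integral_le_of_norm_le_const hb
    rw [probReal_univ, mul_one] at h
    rwa [← integral_sub (f.integrable n) hqn]
  have h1 := key m inferInstance hm (hint q)
  have h2 := key m' inferInstance hm' (hint' q)
  rw [h q] at h1
  rw [Real.dist_eq]
  calc |∫ x, f x ∂m - ∫ x, f x ∂m'|
      = |(∫ x, f x ∂m - ∫ x, q.eval x ∂m') - (∫ x, f x ∂m' - ∫ x, q.eval x ∂m')| := by ring_nf
    _ ≤ _ := abs_sub _ _
    _ ≤ ε := by linarith

/-- Only `m` is assumed compactly supported: `m'` inherits its moments, hence the bound R^(2n), and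
so lives on [-(R+1), R+1]. -/
lemma eq_of_isOrthogonalityMeasure {p : ℕ → ℝ[X]} (hp0 : p 0 = 1)
    (hdeg : ∀ n, (p n).degree = n) {m m' : Measure ℝ} (hm : IsOrthogonalityMeasure p m)
    (hm' : IsOrthogonalityMeasure p m') {R : ℝ} (hR : ∀ᵐ x ∂m, |x| ≤ R) : m' = m := by
  have := hm.isProbabilityMeasure
  have := hm'.isProbabilityMeasure
  have h := integral_eval_eq_of_isOrthogonalityMeasure hp0 hdeg hm hm'
  have hR0 : 0 ≤ R := by
    obtain ⟨x, hx⟩ := hR.exists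
    exact (abs_nonneg x).trans hx
  have hR' : ∀ᵐ x ∂m', |x| ≤ R + 1 := by
    refine ae_abs_le_of_moments_le hm'.integrable_pow hR0 (lt_add_one R) fun n => ?_
    have h1 := h (Polynomial.X ^ (2 * n))
    simp only [Polynomial.eval_pow, Polynomial.eval_X] at h1
    rw [← h1]
    calc ∫ x, x ^ (2 * n) ∂m ≤ ∫ _, R ^ (2 * n) ∂m := by
          refine integral_mono_ae (hm.integrable_pow _) (integrable_const _) ?_
          filter_upwards [hR] with x hx
          rw [← (even_two_mul n).pow_abs x]
          gcongr
      _ = R ^ (2 * n) := by simp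
  refine (measure_eq_of_integral_eval_eq (S := R + 1) ?_ hR' ?_ ?_ h).symm
  · filter_upwards [hR] with x hx
    linarith
  · exact integrable_eval_of_integrable_pow hm.integrable_pow
  · exact integrable_eval_of_integrable_pow hm'.integrable_pow

end Determinacy

/-! ### The spectral measure of the first basis vector -/

namespace EllTwo

/-- The spectral measure of the vector `e 0` for an operator with eigenvalues `x k` and an
eigenbasis `v k`. -/
def spectralMeasure (x : ℕ → ℝ) (v : HilbertBasis ℕ ℂ EllTwo) : Measure ℝ :=
  Measure.sum fun k => ENNReal.ofReal (‖v k 0‖ ^ 2) • Measure.dirac (x k)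

variable {x : ℕ → ℝ} {v : HilbertBasis ℕ ℂ EllTwo}

lemma spectralMeasure_singleton (hx : Function.Injective x) (k : ℕ) :
    spectralMeasure x v {x k} = ENNReal.ofReal (‖v k 0‖ ^ 2) := by
  rw [spectralMeasure, Measure.sum_apply _ (measurableSet_singleton _), tsum_eq_single k]
  · simp
  · intro j hj
    simp [hx.ne hj]

/-- Parseval for `e i`, `e j` in the basis `v`: the coordinate matrix of `v` is unitary, so its
other index is orthonormal as well. This becomes orthogonality of the polynomials. -/
lemma hasSum_apply_mul_star (i j : ℕ) :
    HasSum (fun k => v k i * star (v k j)) (if i = j then 1 else 0) := by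
  have h := v.hasSum_inner_mul_inner (e i) (e j)
  rw [orthonormal_iff_ite.mp orthonormal_e i j] at h
  simpa only [inner_e_left, inner_e_right] using h

lemma isProbabilityMeasure_spectralMeasure : IsProbabilityMeasure (spectralMeasure x v) := by
  have h : HasSum (fun k => ‖v k 0‖ ^ 2) 1 := by
    refine Complex.hasSum_ofReal.mp ?_
    have h := hasSum_apply_mul_star (v := v) 0 0
    simp only [Complex.star_def, Complex.mul_conj, Complex.normSq_eq_norm_sq, if_true] at h
    simpa using h
  constructor
  rw [spectralMeasure, Measure.sum_apply _ MeasurableSet.univ]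
  simp only [Measure.smul_apply, measure_univ, smul_eq_mul, mul_one]
  rw [← ENNReal.ofReal_tsum_of_nonneg (fun k => sq_nonneg _) h.summable, h.tsum_eq,
    ENNReal.ofReal_one]

lemma ae_spectralMeasure {P : ℝ → Prop} (hP : ∀ k, P (x k)) : ∀ᵐ t ∂spectralMeasure x v, P t := by
  rw [spectralMeasure, Measure.ae_sum_iff]
  exact fun k => Measure.ae_smul_measure ((ae_dirac_eq (x k)).symm ▸ hP k) _

lemma integrable_spectralMeasure {R : ℝ} (hR : ∀ k, |x k| ≤ R) {f : ℝ → ℝ} (hf : Continuous f) :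
    Integrable f (spectralMeasure x v) := by
  have := isProbabilityMeasure_spectralMeasure (x := x) (v := v)
  obtain ⟨C, hC⟩ := (isCompact_Icc (a := -R) (b := R)).exists_bound_of_continuousOn hf.continuousOn
  exact Integrable.of_bound hf.aestronglyMeasurable C
    (ae_spectralMeasure fun k => hC _ (abs_le.mp (hR k)))

lemma hasSum_integral_spectralMeasure {R : ℝ} (hR : ∀ k, |x k| ≤ R) {f : ℝ → ℝ}
    (hf : Continuous f) :
    HasSum (fun k => ‖v k 0‖ ^ 2 * f (x k)) (∫ t, f t ∂spectralMeasure x v) := by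
  have h := hasSum_integral_measure (integrable_spectralMeasure (v := v) hR hf)
  simp only [integral_smul_measure, integral_dirac, ENNReal.toReal_ofReal (sq_nonneg _),
    smul_eq_mul] at h
  exact h

/-- If the eigenvectors have coordinates `v k n = v k 0 * (c n * (p n)(x k))`, then the spectral
measure is an orthogonality measure for the polynomials `p`. -/
lemma isOrthogonalityMeasure_spectralMeasure {R : ℝ} (hR : ∀ k, |x k| ≤ R) {p : ℕ → ℝ[X]}
    {c : ℕ → ℝ} (hc : ∀ n, c n ≠ 0)
    (hv : ∀ k n, v k n = v k 0 * ((c n * (p n).eval (x k) : ℝ) : ℂ)) :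
    IsOrthogonalityMeasure p (spectralMeasure x v) := by
  have key : ∀ i j, ∫ t, (p i).eval t * (p j).eval t ∂spectralMeasure x v
      = if i = j then (c i * c j)⁻¹ else 0 := by
    intro i j
    have h1 := (hasSum_integral_spectralMeasure (v := v) hR
      (f := fun t => (p i).eval t * (p j).eval t) (by fun_prop)).mul_left (c i * c j)
    have h2 := hasSum_apply_mul_star (v := v) i j
    have h3 : ∀ k, v k i * star (v k j) =
        ((c i * c j * (‖v k 0‖ ^ 2 * ((p i).eval (x k) * (p j).eval (x k))) : ℝ) : ℂ) := by
      intro k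
      rw [hv k i, hv k j, star_mul, Complex.star_def, Complex.conj_ofReal]
      have h4 : v k 0 * (starRingEnd ℂ) (v k 0) = ((‖v k 0‖ ^ 2 : ℝ) : ℂ) := by
        rw [Complex.mul_conj, Complex.normSq_eq_norm_sq]
      rw [← Complex.star_def] at h4 ⊢
      push_cast at h4 ⊢
      linear_combination (c i * (p i).eval (x k) * (c j * (p j).eval (x k)) : ℂ) * h4
    simp_rw [h3] at h2
    have h5 := (Complex.hasSum_ofReal.mpr h1).unique h2
    have h6 : c i * c j * ∫ t, (p i).eval t * (p j).eval t ∂spectralMeasure x v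
        = if i = j then 1 else 0 := by
      refine Complex.ofReal_injective ?_
      rw [h5]
      split_ifs <;> simp
    have h7 : c i * c j ≠ 0 := mul_ne_zero (hc i) (hc j)
    split_ifs at h6 ⊢
    · exact eq_inv_of_mul_eq_one_right h6
    · exact (mul_eq_zero.mp h6).resolve_left h7
  refine ⟨isProbabilityMeasure_spectralMeasure, fun k => integrable_spectralMeasure hR
    (by fun_prop), fun i j hij => by rw [key, if_neg hij], fun i => ?_⟩
  simp only [sq]
  rw [key, if_pos rfl]
  exact inv_pos.mpr (mul_self_pos.mpr (hc i))

end EllTwo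

/-! ### Three-term recurrences and the spectral theorem for Jacobi operators -/

namespace EllTwo

variable {A b : ℕ → ℝ}

/-- A solution of a three-term recurrence is determined by its value at `0`. -/
lemma eq_of_three_term_recurrence (hA : ∀ n, A n ≠ 0) {l : ℂ} {f g : ℕ → ℂ}
    (hf0 : l * f 0 = b 0 * f 0 + A 0 * f 1)
    (hf : ∀ n, l * f (n + 1) = b (n + 1) * f (n + 1) + A (n + 1) * f (n + 2) + A n * f n)
    (hg0 : l * g 0 = b 0 * g 0 + A 0 * g 1)
    (hg : ∀ n, l * g (n + 1) = b (n + 1) * g (n + 1) + A (n + 1) * g (n + 2) + A n * g n)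
    (h0 : f 0 = g 0) : ∀ n, f n = g n := by
  have hA' : ∀ n, (A n : ℂ) ≠ 0 := fun n => by exact_mod_cast hA n
  have key : ∀ n, f n = g n ∧ f (n + 1) = g (n + 1) := by
    intro n
    induction n with
    | zero =>
      refine ⟨h0, mul_left_cancel₀ (hA' 0) ?_⟩
      rw [h0] at hf0
      linear_combination hg0 - hf0
    | succ n ih =>
      refine ⟨ih.2, mul_left_cancel₀ (hA' (n + 1)) ?_⟩
      have h1 := hf n
      rw [ih.1, ih.2] at h1
      linear_combination hg n - h1
  exact fun n => (key n).1

lemma tendsto_apply_zero (f : EllTwo) : Tendsto (fun n => f n) atTop (𝓝 0) := by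
  have h := (lp.summable_inner (𝕜 := ℂ) f f).tendsto_atTop_zero.norm
  simp only [inner_self_eq_norm_sq_to_K, norm_zero] at h
  have h2 : Tendsto (fun n => ‖f n‖ ^ 2) atTop (𝓝 0) := by simpa using h
  have h3 := h2.sqrt
  simp only [Real.sqrt_zero, Real.sqrt_sq (norm_nonneg _)] at h3
  exact tendsto_zero_iff_norm_tendsto_zero.mpr h3

/-- Coordinates of an eigenvector of a Jacobi operator in terms of the orthonormal polynomials. -/
lemma eigenvector_apply (hAs : Summable fun n => |A n|) (hbs : Summable fun n => |b n|)
    (hA : ∀ n, A n ≠ 0) {P : ℕ → ℝ} {l : ℝ} (hP : P 0 = 1)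
    (hP0 : l * P 0 = b 0 * P 0 + A 0 * P 1)
    (hPn : ∀ n, l * P (n + 1) = b (n + 1) * P (n + 1) + A (n + 1) * P (n + 2) + A n * P n)
    {f : EllTwo} (hf : tridiag A b f = (l : ℂ) • f) (n : ℕ) : f n = f 0 * (P n : ℂ) := by
  have hf' : ∀ k, (tridiag A b f : EllTwo) k = l * f k := fun k => by rw [hf]; rfl
  refine eq_of_three_term_recurrence (f := fun n => f n) (g := fun n => f 0 * (P n : ℂ)) hA
    (l := l) (b := b) ?_ ?_ ?_ ?_ ?_ n
  · rw [← hf', tridiag_apply_zero hAs hbs]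
  · intro k
    rw [← hf', tridiag_apply_succ hAs hbs]
  · have h : (l : ℂ) * P 0 = b 0 * P 0 + A 0 * P 1 := by exact_mod_cast hP0
    linear_combination f 0 * h
  · intro k
    have h : (l : ℂ) * P (k + 1) = b (k + 1) * P (k + 1) + A (k + 1) * P (k + 2) + A k * P k := by
      exact_mod_cast hPn k
    linear_combination f 0 * h
  · simp [hP]

lemma eigenvector_eq_zero (hAs : Summable fun n => |A n|) (hbs : Summable fun n => |b n|)
    (hA : ∀ n, A n ≠ 0) {l : ℂ} {f : EllTwo} (hf : tridiag A b f = l • f) (h0 : f 0 = 0) :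
    f = 0 := by
  have hf' : ∀ k, (tridiag A b f : EllTwo) k = l * f k := fun k => by rw [hf]; rfl
  ext n
  refine eq_of_three_term_recurrence (f := fun n => f n) (g := fun _ => 0) hA
    (l := l) (b := b) ?_ ?_ ?_ ?_ h0 n
  · rw [← hf', tridiag_apply_zero hAs hbs]
  · intro k
    rw [← hf', tridiag_apply_succ hAs hbs]
  · simp
  · simp

/-- Spectral theory of a Jacobi operator with summable entries whose orthonormal polynomials
`c n * p n` do not tend to zero at the origin. -/
theorem spectral_tridiag (hAs : Summable fun n => |A n|) (hbs : Summable fun n => |b n|)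
    (hA : ∀ n, A n ≠ 0) {p : ℕ → ℝ[X]} {c : ℕ → ℝ} (hp0 : p 0 = 1)
    (hdeg : ∀ n, (p n).degree = n) (hc0 : c 0 = 1) (hc : ∀ n, c n ≠ 0)
    (hrec0 : ∀ t, t * (c 0 * (p 0).eval t) = b 0 * (c 0 * (p 0).eval t)
      + A 0 * (c 1 * (p 1).eval t))
    (hrec : ∀ t n, t * (c (n + 1) * (p (n + 1)).eval t) =
      b (n + 1) * (c (n + 1) * (p (n + 1)).eval t)
      + A (n + 1) * (c (n + 2) * (p (n + 2)).eval t) + A n * (c n * (p n).eval t))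
    (hzero : ¬ Tendsto (fun n => c n * (p n).eval 0) atTop (𝓝 0)) :
    IsCompactOperator (tridiag A b) ∧ IsTraceClass (tridiag A b) ∧
    ∃ x : ℕ → ℝ, Function.Injective x ∧ (∀ k, x k ≠ 0) ∧
      spectrum ℂ (tridiag A b) = insert 0 (Set.range fun k => (x k : ℂ)) ∧
      {z : ℂ | AccPt z (𝓟 (spectrum ℂ (tridiag A b)))} = {0} ∧
      Tendsto x atTop (𝓝 0) ∧ (Summable fun k => |x k|) ∧
      ∃ m : Measure ℝ, IsOrthogonalityMeasure p m ∧
        (∀ m' : Measure ℝ, IsOrthogonalityMeasure p m' → m' = m) ∧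
        (∀ k, 0 < m {x k}) ∧ m = Measure.sum fun k => m {x k} • Measure.dirac (x k) := by
  have hcomp := isCompactOperator_tridiag hAs hbs
  have hself : IsSelfAdjoint (tridiag A b) := isSelfAdjoint_tridiag
  have hcoord : ∀ (l : ℝ) (f : EllTwo), tridiag A b f = (l : ℂ) • f →
      ∀ n, f n = f 0 * ((c n * (p n).eval l : ℝ) : ℂ) := fun l f hf =>
    eigenvector_apply hAs hbs hA (P := fun n => c n * (p n).eval l) (by simp [hc0, hp0])
      (hrec0 l) (hrec l) hf
  -- A kernel vector is f 0 times the sequence c_n p_n(0); its coordinates tend to 0, so `hzero`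
  -- forces f 0 = 0.
  have hinj : ∀ f, tridiag A b f = 0 → f = 0 := by
    intro f hf
    have hf0 : tridiag A b f = ((0 : ℝ) : ℂ) • f := by rw [hf, Complex.ofReal_zero, zero_smul]
    refine eigenvector_eq_zero hAs hbs hA hf0 (by_contra fun hne => hzero ?_)
    have h := (tendsto_apply_zero f).const_mul (f 0)⁻¹
    rw [mul_zero] at h
    have h2 := (Complex.continuous_re.tendsto _).comp h
    refine h2.congr fun n => ?_
    rw [Function.comp_apply, hcoord 0 f hf0 n, inv_mul_cancel_left₀ hne, Complex.ofReal_re]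
  obtain ⟨x, v, hxinj, hxne, hv, hev⟩ := exists_hilbertBasis_eigenvectors hcomp hself.isSymmetric
    hinj (fun l f => eigenvector_eq_zero hAs hbs hA)
    (fun ι v hv => summable_norm_inner_tridiag hAs hbs hv)
  have hsum : Summable fun k => |x k| := by
    have h := summable_norm_inner_tridiag hAs hbs v.orthonormal
    simp_rw [inner_eigenvector hv, Complex.norm_real, Real.norm_eq_abs] at h
    exact h
  have hlim : Tendsto x atTop (𝓝 0) :=
    (tendsto_zero_iff_abs_tendsto_zero _).mpr hsum.tendsto_atTop_zero
  have hspec := spectrum_eq_of_eigenbasis hcomp hxne hv hev hlim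
  have hR : ∀ k, |x k| ≤ ∑' j, |x j| := fun k => hsum.le_tsum k fun _ _ => abs_nonneg _
  have hvc : ∀ k n, v k n = v k 0 * ((c n * (p n).eval (x k) : ℝ) : ℂ) :=
    fun k => hcoord (x k) (v k) (hv k)
  have hm := isOrthogonalityMeasure_spectralMeasure hR hc hvc
  refine ⟨hcomp, isTraceClass_of_eigenbasis hself hxne hv hsum, x, hxinj, hxne, hspec, ?_, hlim,
    hsum, spectralMeasure x v, hm,
    fun m' hm' => eq_of_isOrthogonalityMeasure hp0 hdeg hm hm' (ae_spectralMeasure hR), ?_, ?_⟩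
  · rw [hspec]
    exact accPt_insert_range hxne hlim
  · intro k
    rw [spectralMeasure_singleton hxinj, ENNReal.ofReal_pos]
    have : v k 0 ≠ 0 := fun h => v.orthonormal.ne_zero k (eigenvector_eq_zero hAs hbs hA (hv k) h)
    positivity
  · simp only [spectralMeasure_singleton hxinj]
    rfl

end EllTwo

/-! ### Lower growth bound for elliptic recurrences -/

section Growth

lemma quadratic_form_lower_bound {c : ℝ} (v w : ℝ) :
    (1 - |c|) * (v ^ 2 + w ^ 2) ≤ v ^ 2 + 2 * c * w * v + w ^ 2 := by
  have h1 : |2 * c * w * v| ≤ |c| * (v ^ 2 + w ^ 2) := by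
    rw [show 2 * c * w * v = c * (2 * w * v) by ring, abs_mul]
    refine mul_le_mul_of_nonneg_left (abs_le.mpr ⟨?_, ?_⟩) (abs_nonneg c) <;>
      nlinarith [sq_nonneg (v - w), sq_nonneg (v + w)]
  linarith [neg_abs_le (2 * c * w * v)]

/-- One step of a perturbed elliptic recurrence increases the scaled quadratic form. -/
lemma quadratic_form_step {c u v w r δ n : ℝ} (hc : |c| < 1) (hr : u + w + 2 * c * v = 2 * r)
    (hδ : |r| ≤ δ * (|u| + |v| + |w|)) (hδ0 : 0 ≤ δ) (hn : 0 ≤ n)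
    (hδn : (2 * n + 1) * (6 * δ) ≤ 1 - |c|) :
    n * (v ^ 2 + 2 * c * w * v + w ^ 2) ≤ (n + 1) * (u ^ 2 + 2 * c * v * u + v ^ 2) := by
  have h1 := quadratic_form_lower_bound (c := c) v w
  have h2 := quadratic_form_lower_bound (c := c) u v
  set E := v ^ 2 + 2 * c * w * v + w ^ 2
  set F := u ^ 2 + 2 * c * v * u + v ^ 2
  -- The form is exactly conserved by the unperturbed recurrence r = 0.
  have hdiff : F - E = (u - w) * (2 * r) := by
    rw [← hr]; ring
  set S := u ^ 2 + v ^ 2 + w ^ 2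
  have hS : |(u - w) * (2 * r)| ≤ 6 * δ * S := by
    rw [abs_mul, abs_mul, abs_two]
    have h3 : |u - w| ≤ |u| + |v| + |w| := by linarith [abs_sub u w, abs_nonneg v]
    have h4 : (|u| + |v| + |w|) ^ 2 ≤ 3 * S := by
      simp only [S, ← sq_abs u, ← sq_abs v, ← sq_abs w]
      nlinarith [sq_nonneg (|u| - |v|), sq_nonneg (|u| - |w|), sq_nonneg (|v| - |w|)]
    calc |u - w| * (2 * |r|)
        ≤ (|u| + |v| + |w|) * (2 * (δ * (|u| + |v| + |w|))) := by gcongr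
      _ = 2 * δ * (|u| + |v| + |w|) ^ 2 := by ring
      _ ≤ 2 * δ * (3 * S) := by gcongr
      _ = 6 * δ * S := by ring
  have hEF : (1 - |c|) * S ≤ E + F := by
    have : 0 ≤ (1 - |c|) * v ^ 2 := mul_nonneg (by linarith) (sq_nonneg v)
    simp only [S]
    linarith
  have hS0 : 0 ≤ S := by positivity
  have h5 : (2 * n + 1) * (6 * δ) * S ≤ (1 - |c|) * S := by gcongr
  have h6 : -(6 * δ * S) ≤ F - E := by rw [hdiff]; exact (abs_le.mp hS).1
  -- (n+1)F - nE = (n + 1/2)(F - E) + (E + F)/2; the first term is at least -(n + 1/2) 6δS, the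
  -- second at least (1 - |c|)S/2.
  nlinarith

/-- Solutions of an elliptic three-term recurrence with `o(1/n)` perturbations do not decay faster
than `n ^ (-1/2)`. -/
lemma not_tendsto_of_elliptic_recurrence {c : ℝ} (hc : |c| < 1) {φ β d : ℕ → ℝ} (hφ : φ 0 ≠ 0)
    (hβ0 : ∀ n, β n ≠ 0)
    (hrec : ∀ n, (c - d (n + 1)) * φ (n + 1) + β (n + 1) * φ (n + 2) + β n * φ n = 0)
    (hβ : Tendsto (fun n : ℕ => (n : ℝ) * |β n - 1 / 2|) atTop (𝓝 0))
    (hd : Tendsto (fun n : ℕ => (n : ℝ) * |d n|) atTop (𝓝 0)) :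
    ¬ Tendsto (fun n : ℕ => (n : ℝ) * φ n ^ 2) atTop (𝓝 0) := by
  intro hlim
  set E : ℕ → ℝ := fun n => φ (n + 1) ^ 2 + 2 * c * φ n * φ (n + 1) + φ n ^ 2 with hE
  -- Two consecutive zeros would propagate down to φ 0, as no β n vanishes.
  have hpos : ∀ n, 0 < φ (n + 1) ^ 2 + φ n ^ 2 := by
    intro n
    induction n with
    | zero => positivity
    | succ n ih =>
      by_contra hcon
      have h1 : φ (n + 1) = 0 := by nlinarith [sq_nonneg (φ (n + 2)), sq_nonneg (φ (n + 1))]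
      have h2 : φ (n + 2) = 0 := by nlinarith [sq_nonneg (φ (n + 2)), sq_nonneg (φ (n + 1))]
      have h3 := hrec n
      rw [h1, h2, mul_zero, mul_zero, zero_add, zero_add, mul_eq_zero] at h3
      rw [h1, h3.resolve_left (hβ0 n)] at ih
      simp at ih
  have hEpos : ∀ n, 0 < E n := fun n =>
    (mul_pos (by linarith) (hpos n)).trans_le (quadratic_form_lower_bound (c := c) _ _)
  have hElim : Tendsto (fun n : ℕ => (n : ℝ) * E n) atTop (𝓝 0) := by
    have hs : Tendsto (fun n : ℕ => 2 * (((n + 1 : ℕ) : ℝ) * φ (n + 1) ^ 2 + n * φ n ^ 2)) atTop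
        (𝓝 0) := by
      simpa using ((hlim.comp (tendsto_add_atTop_nat 1)).add hlim).const_mul 2
    refine squeeze_zero (fun n => by have := hEpos n; positivity) (fun n => ?_) hs
    have h1 : E n ≤ 2 * (φ (n + 1) ^ 2 + φ n ^ 2) := by
      have h := quadratic_form_lower_bound (c := -c) (φ (n + 1)) (φ n)
      rw [abs_neg] at h
      have h2 : |c| * (φ (n + 1) ^ 2 + φ n ^ 2) ≤ 1 * (φ (n + 1) ^ 2 + φ n ^ 2) := by gcongr
      simp only [hE]
      linarith
    have h2 : (n : ℝ) * E n ≤ n * (2 * (φ (n + 1) ^ 2 + φ n ^ 2)) := by gcongr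
    push_cast
    nlinarith [sq_nonneg (φ (n + 1))]
  -- The factor 3 absorbs 2n + 1 ≤ 3n, and (1 - |c|)/6 matches the 6δ in `quadratic_form_step`.
  have hev : ∀ {f : ℕ → ℝ}, Tendsto (fun n : ℕ => (n : ℝ) * |f n|) atTop (𝓝 0) →
      ∀ᶠ n : ℕ in atTop, 3 * ((n : ℝ) * |f n|) ≤ (1 - |c|) / 6 := by
    intro f hf
    have h3 := hf.const_mul 3
    rw [mul_zero] at h3
    exact h3.eventually_le_const (by linarith)
  have hstep : ∀ᶠ n : ℕ in atTop, (n : ℝ) * E n ≤ ((n + 1 : ℕ) : ℝ) * E (n + 1) := by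
    filter_upwards [hev hβ, (tendsto_add_atTop_nat 1).eventually (hev hβ),
      (tendsto_add_atTop_nat 1).eventually (hev hd), eventually_ge_atTop 1] with n h1 h2 h3 hn
    have hn' : (1 : ℝ) ≤ n := by exact_mod_cast hn
    have hδ : ∀ y k : ℝ, (n : ℝ) ≤ k → 3 * (k * |y|) ≤ (1 - |c|) / 6 →
        |y| ≤ (1 - |c|) / 6 / (2 * n + 1) := by
      intro y k hk hy
      rw [le_div_iff₀ (by positivity)]
      nlinarith [abs_nonneg y]
    have h1' := hδ _ _ le_rfl h1
    have h2' := hδ _ _ (by push_cast; linarith) h2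
    have h3' := hδ _ _ (by push_cast; linarith) h3
    have hδ0 : 0 ≤ (1 - |c|) / 6 / (2 * n + 1) := div_nonneg (by linarith) (by positivity)
    push_cast
    refine quadratic_form_step (u := φ (n + 2)) (v := φ (n + 1)) (w := φ n)
      (r := -(β (n + 1) - 1 / 2) * φ (n + 2) + -(β n - 1 / 2) * φ n + d (n + 1) * φ (n + 1))
      (δ := (1 - |c|) / 6 / (2 * n + 1)) hc ?_ ?_ hδ0 (by positivity) ?_
    · linear_combination 2 * hrec n
    · refine (abs_add_three _ _ _).trans ?_
      rw [abs_mul, abs_mul, abs_mul, abs_neg, abs_neg]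
      have e1 := mul_le_mul_of_nonneg_right h2' (abs_nonneg (φ (n + 2)))
      have e2 := mul_le_mul_of_nonneg_right h1' (abs_nonneg (φ n))
      have e3 := mul_le_mul_of_nonneg_right h3' (abs_nonneg (φ (n + 1)))
      linarith
    · field_simp
      exact le_rfl
  obtain ⟨N, hN⟩ := eventually_atTop.mp hstep
  have hmono : ∀ n, N + 1 ≤ n → ((N + 1 : ℕ) : ℝ) * E (N + 1) ≤ n * E n := by
    intro n hn
    induction n, hn using Nat.le_induction with
    | base => exact le_rfl
    | succ n hn ih => exact ih.trans (hN n (by omega))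
  have hle := ge_of_tendsto hElim (eventually_atTop.mpr ⟨N + 1, hmono⟩)
  have := hEpos (N + 1)
  have : 0 < ((N + 1 : ℕ) : ℝ) * E (N + 1) := by positivity
  linarith

end Growth

/-! ### The coefficients of the first family: positivity and asymptotics -/

namespace FirstFamily

variable {μ ν α θ : ℝ}

section Positivity

/-- The increment from index 0 is n(n + μ + ν + 1), positive for n ≥ 1. -/
lemma quad_pos (hμ : -1 < μ) (hν : -1 < ν) (hα : 0 < ((μ + ν + 1) / 2) ^ 2 + α) (n : ℕ) :
    0 < quad μ ν α n := by
  unfold quad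
  rcases Nat.eq_zero_or_pos n with rfl | hn
  · simpa using hα
  · have h1 : (1 : ℝ) ≤ n := by exact_mod_cast hn
    nlinarith [mul_pos (show (0 : ℝ) < n by linarith) (show (0 : ℝ) < n + μ + ν + 1 by linarith)]

lemma upCoeff_pos (hμ : -1 < μ) (hν : -1 < ν) (n : ℕ) : 0 < upCoeff μ ν n := by
  unfold upCoeff
  split_ifs with h
  · exact div_pos two_pos (by linarith)
  · have h1 : (1 : ℝ) ≤ n := by exact_mod_cast Nat.one_le_iff_ne_zero.mpr h
    have h2 : 0 < n + μ + ν + 1 := by linarith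
    have h3 : 0 < 2 * n + μ + ν + 1 := by linarith
    have h4 : 0 < 2 * n + μ + ν + 2 := by linarith
    positivity

lemma downCoeff_succ_pos (hμ : -1 < μ) (hν : -1 < ν) (n : ℕ) : 0 < downCoeff μ ν (n + 1) := by
  unfold downCoeff
  have h0 : (0 : ℝ) ≤ n := n.cast_nonneg
  push_cast
  have h1 : 0 < (n : ℝ) + 1 + μ := by linarith
  have h2 : 0 < (n : ℝ) + 1 + ν := by linarith
  have h3 : 0 < 2 * ((n : ℝ) + 1) + μ + ν := by linarith
  have h4 : 0 < 2 * ((n : ℝ) + 1) + μ + ν + 1 := by linarith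
  positivity

/-- Symmetrizing a recurrence gives as squared off-diagonal entry the product of the two opposite
neighbour coefficients. The cancelled factor in `aSq` at 1 is the one in `upCoeff` at 0. -/
lemma aSq_succ (hμ : -1 < μ) (hν : -1 < ν) (n : ℕ) : aSq μ ν α θ (n + 1) =
    upCoeff μ ν n * downCoeff μ ν (n + 1) /
      (Real.sin θ ^ 2 * quad μ ν α n * quad μ ν α (n + 1 : ℕ)) := by
  unfold aSq upCoeff downCoeff
  rcases Nat.eq_zero_or_pos n with rfl | hn
  · have h1 : μ + ν + 2 ≠ 0 := by linarith
    have h2 : μ + ν + 3 ≠ 0 := by linarith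
    simp only [zero_add, if_true, Nat.cast_zero, Nat.cast_one]
    rw [div_mul_div_comm, div_div]
    congr 1 <;> ring
  · simp only [Nat.add_eq_right, hn.ne', if_false]
    push_cast
    rw [div_mul_div_comm, div_div]
    rw [show (n : ℝ) + 1 - 1 = n by ring]
    congr 1 <;> ring

lemma a_succ_pos (hμ : -1 < μ) (hν : -1 < ν) (hθ : 0 < Real.sin θ)
    (hα : 0 < ((μ + ν + 1) / 2) ^ 2 + α) (n : ℕ) : 0 < a μ ν α θ (n + 1) := by
  rw [a, Real.sqrt_pos, aSq_succ hμ hν]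
  have h1 := quad_pos hμ hν hα n
  have h2 := quad_pos hμ hν hα (n + 1)
  have h3 := upCoeff_pos hμ hν n
  have h4 := downCoeff_succ_pos hμ hν n
  positivity

lemma a_succ_sq (hμ : -1 < μ) (hν : -1 < ν) (hθ : 0 < Real.sin θ)
    (hα : 0 < ((μ + ν + 1) / 2) ^ 2 + α) (n : ℕ) : a μ ν α θ (n + 1) ^ 2 =
    upCoeff μ ν n * downCoeff μ ν (n + 1) /
      (Real.sin θ ^ 2 * quad μ ν α n * quad μ ν α (n + 1 : ℕ)) := by
  rw [← aSq_succ hμ hν]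
  refine Real.sq_sqrt (Real.sqrt_pos.mp ?_).le
  exact a_succ_pos hμ hν hθ hα n

end Positivity

section Asymptotics

lemma isEquivalent_linear {k : ℝ} (hk : k ≠ 0) (s : ℝ) :
    (fun n : ℕ => k * n + s) ~[atTop] fun n : ℕ => k * n := by
  refine IsEquivalent.refl.add_isLittleO (isLittleO_const_left.mpr (Or.inr ?_))
  refine (tendsto_natCast_atTop_atTop.const_mul_atTop (abs_pos.mpr hk)).congr fun n => ?_
  simp

lemma isEquivalent_quad (μ ν α s : ℝ) :
    (fun n : ℕ => quad μ ν α (n + s)) ~[atTop] fun n : ℕ => (n : ℝ) ^ 2 := by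
  have h : (fun n : ℕ => (n : ℝ) + (s + (μ + ν + 1) / 2)) ~[atTop] fun n : ℕ => (n : ℝ) := by
    simpa using isEquivalent_linear one_ne_zero (s + (μ + ν + 1) / 2)
  have h2 : (fun _ : ℕ => α) =o[atTop] fun n : ℕ => (n : ℝ) ^ 2 :=
    isLittleO_const_left.mpr (Or.inr (tendsto_norm_atTop_atTop.comp
      ((tendsto_pow_atTop two_ne_zero).comp tendsto_natCast_atTop_atTop)))
  refine ((h.pow 2).add_isLittleO h2).congr_left (Eventually.of_forall fun n => ?_)
  simp only [quad, Pi.pow_apply, Pi.add_apply]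
  ring

/-- `1 / ∏ (kᵢ n + sᵢ)` for two linear factors is `O(1/n²)`. -/
lemma isBigO_inv_mul_linear {k k' : ℝ} (hk : k ≠ 0) (hk' : k' ≠ 0) (s s' : ℝ) :
    (fun n : ℕ => ((k * n + s) * (k' * n + s'))⁻¹) =O[atTop] fun n : ℕ => 1 / (n : ℝ) ^ 2 := by
  refine (((isEquivalent_linear hk s).mul (isEquivalent_linear hk' s')).inv.isBigO).trans ?_
  refine (isBigO_const_mul_self (k * k')⁻¹ _ _).congr_left fun n => ?_
  simp only [Pi.inv_apply, Pi.mul_apply]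
  field_simp

lemma diagCoeff_isBigO (μ ν : ℝ) :
    (fun n : ℕ => diagCoeff μ ν n) =O[atTop] fun n : ℕ => 1 / (n : ℝ) ^ 2 := by
  refine ((isBigO_inv_mul_linear two_ne_zero two_ne_zero (μ + ν) (μ + ν + 2)).const_mul_left
    (ν ^ 2 - μ ^ 2)).congr' ?_ EventuallyEq.rfl
  filter_upwards [eventually_ne_atTop 0] with n hn
  rw [diagCoeff, if_neg hn, div_eq_mul_inv]
  ring_nf

lemma isBigO_one_div_pow_one (k : ℕ) :
    (fun n : ℕ => 1 / (n : ℝ) ^ k) =O[atTop] fun _ : ℕ => (1 : ℝ) := by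
  refine IsBigO.of_bound 1 ?_
  filter_upwards [eventually_ge_atTop 1] with n hn
  have : (1 : ℝ) ≤ n := by exact_mod_cast hn
  simp only [norm_div, norm_one, norm_pow, Real.norm_natCast, mul_one]
  exact div_le_one_of_le₀ (one_le_pow₀ this) (by positivity)

lemma b_isBigO (μ ν α θ : ℝ) :
    (fun n : ℕ => b μ ν α θ n) =O[atTop] fun n : ℕ => 1 / (n : ℝ) ^ 2 := by
  have h1 : (fun n : ℕ => 1 / (Real.sin θ * quad μ ν α n)) =O[atTop]
      fun n : ℕ => 1 / (n : ℝ) ^ 2 := by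
    have h := (isEquivalent_quad μ ν α 0).inv.isBigO.const_mul_left (Real.sin θ)⁻¹
    refine h.congr (fun n => ?_) fun n => ?_
    · simp [mul_comm]
    · simp
  have h2 : (fun n : ℕ => Real.cos θ - diagCoeff μ ν n) =O[atTop] fun _ : ℕ => (1 : ℝ) :=
    (isBigO_const_const _ one_ne_zero _).sub
      ((diagCoeff_isBigO μ ν).trans (isBigO_one_div_pow_one 2))
  simpa [b] using h1.mul h2

lemma aSq_isBigO (μ ν α θ : ℝ) :
    (fun n : ℕ => aSq μ ν α θ n) =O[atTop] fun n : ℕ => 1 / (n : ℝ) ^ 4 := by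
  have hl : ∀ s, (fun n : ℕ => (n : ℝ) + s) ~[atTop] fun n : ℕ => (n : ℝ) := fun s => by
    simpa using isEquivalent_linear one_ne_zero s
  have hnum := (((hl 0).mul (hl μ)).mul (hl ν)).mul (hl (μ + ν))
  have hden := (((isEquivalent_quad μ ν α 0).mul (isEquivalent_quad μ ν α (-1))).mul
    (isEquivalent_linear two_ne_zero (μ + ν + 1))).mul
    (((isEquivalent_linear two_ne_zero (μ + ν)).pow 2).mul
      (isEquivalent_linear two_ne_zero (μ + ν - 1)))
  have h := (hnum.div hden).isBigO.const_mul_left (4 / Real.sin θ ^ 2)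
  refine (h.congr' ?_ EventuallyEq.rfl).trans ?_
  · filter_upwards [eventually_ne_atTop 1] with n hn
    rw [aSq, if_neg hn]
    simp only [Pi.mul_apply, Pi.div_apply, Pi.pow_apply, add_zero]
    rw [div_mul_div_comm]
    congr 1
    · ring
    · rw [← sub_eq_add_neg]
      ring
  -- 16 = 2 · 2² · 2 comes from the linear factors of the denominator.
  · refine (isBigO_const_mul_self (1 / 16) (fun n : ℕ => 1 / (n : ℝ) ^ 4) atTop).congr' ?_
      EventuallyEq.rfl
    filter_upwards [eventually_ne_atTop 0] with n hn
    have : (n : ℝ) ≠ 0 := by exact_mod_cast hn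
    simp only [Pi.mul_apply, Pi.div_apply, Pi.pow_apply]
    field_simp
    norm_num

lemma summable_of_isBigO_one_div_sq {f : ℕ → ℝ}
    (hf : f =O[atTop] fun n : ℕ => 1 / (n : ℝ) ^ 2) : Summable fun n => |f n| :=
  (summable_of_isBigO_nat (Real.summable_one_div_nat_pow.mpr one_lt_two) hf).abs

lemma a_isBigO (μ ν α θ : ℝ) :
    (fun n : ℕ => a μ ν α θ n) =O[atTop] fun n : ℕ => 1 / (n : ℝ) ^ 2 := by
  obtain ⟨C, hC⟩ := (aSq_isBigO μ ν α θ).bound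
  refine IsBigO.of_bound (Real.sqrt C) ?_
  filter_upwards [hC] with n hn
  rw [a, Real.norm_eq_abs, abs_of_nonneg (Real.sqrt_nonneg _)]
  have h1 : ‖1 / (n : ℝ) ^ 4‖ = ‖1 / (n : ℝ) ^ 2‖ ^ 2 := by
    rw [← norm_pow]
    congr 1
    ring
  rw [h1] at hn
  calc Real.sqrt (aSq μ ν α θ n) ≤ Real.sqrt (C * ‖1 / (n : ℝ) ^ 2‖ ^ 2) :=
        Real.sqrt_le_sqrt ((le_abs_self _).trans hn)
    _ = Real.sqrt C * ‖1 / (n : ℝ) ^ 2‖ := by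
        rw [Real.sqrt_mul' _ (sq_nonneg _), Real.sqrt_sq (norm_nonneg _)]

/-- `n f(n) → 0` when `f = O(1/n²)`. -/
lemma tendsto_mul_abs_of_isBigO {f : ℕ → ℝ} (hf : f =O[atTop] fun n : ℕ => 1 / (n : ℝ) ^ 2) :
    Tendsto (fun n : ℕ => (n : ℝ) * |f n|) atTop (𝓝 0) := by
  have h := (isBigO_refl (fun n : ℕ => (n : ℝ)) atTop).mul hf.abs_left
  refine h.trans_tendsto (tendsto_one_div_atTop_nhds_zero_nat.congr fun n => ?_)
  rcases eq_or_ne n 0 with rfl | hn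
  · simp
  · field_simp

/-- The off-diagonal coefficients of the Jacobi polynomials. -/
def jacobiOffDiag (μ ν : ℝ) (n : ℕ) : ℝ := Real.sqrt (upCoeff μ ν n * downCoeff μ ν (n + 1))

lemma jacobiOffDiag_pos (hμ : -1 < μ) (hν : -1 < ν) (n : ℕ) : 0 < jacobiOffDiag μ ν n :=
  Real.sqrt_pos.mpr (mul_pos (upCoeff_pos hμ hν n) (downCoeff_succ_pos hμ hν n))

lemma jacobiOffDiag_sq (hμ : -1 < μ) (hν : -1 < ν) (n : ℕ) :
    jacobiOffDiag μ ν n ^ 2 = upCoeff μ ν n * downCoeff μ ν (n + 1) :=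
  Real.sq_sqrt (mul_pos (upCoeff_pos hμ hν n) (downCoeff_succ_pos hμ hν n)).le

lemma jacobiOffDiag_sq_isBigO (hμ : -1 < μ) (hν : -1 < ν) :
    (fun n : ℕ => jacobiOffDiag μ ν n ^ 2 - 1 / 4) =O[atTop] fun n : ℕ => 1 / (n : ℝ) ^ 2 := by
  have h1 := isBigO_inv_mul_linear two_ne_zero two_ne_zero (μ + ν + 1) (μ + ν + 3)
  have h2 := (isBigO_inv_mul_linear two_ne_zero two_ne_zero (μ + ν + 2) (μ + ν + 2)).trans
    (isBigO_one_div_pow_one 2)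
  -- This bounded factor over (2n+μ+ν+1)(2n+μ+ν+3) equals the difference exactly for n ≥ 1.
  have h3 : (fun n : ℕ => (1 - (μ + ν) ^ 2 - (μ - ν) ^ 2) / 4 + (μ + ν) ^ 2 * (μ - ν) ^ 2 / 4 *
      ((2 * n + (μ + ν + 2)) * (2 * n + (μ + ν + 2)))⁻¹) =O[atTop] fun _ : ℕ => (1 : ℝ) :=
    (isBigO_const_const _ one_ne_zero _).add (h2.const_mul_left _)
  refine ((h3.mul h1).congr' ?_ (Eventually.of_forall fun n => one_mul _))
  filter_upwards [eventually_ge_atTop 1] with n hn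
  have hn1 : (1 : ℝ) ≤ n := by exact_mod_cast hn
  have e1 : 2 * (n : ℝ) + (μ + ν + 1) ≠ 0 := by linarith
  have e2 : 2 * (n : ℝ) + (μ + ν + 2) ≠ 0 := by linarith
  have e3 : 2 * (n : ℝ) + (μ + ν + 3) ≠ 0 := by linarith
  have hprod : upCoeff μ ν n * downCoeff μ ν (n + 1) =
      4 * (n + 1) * (n + 1 + μ) * (n + 1 + ν) * (n + 1 + μ + ν) /
        ((2 * n + (μ + ν + 1)) * (2 * n + (μ + ν + 2)) ^ 2 * (2 * n + (μ + ν + 3))) := by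
    rw [upCoeff, downCoeff, if_neg (by omega), div_mul_div_comm]
    push_cast
    congr 1 <;> ring
  rw [jacobiOffDiag_sq hμ hν, hprod]
  field_simp
  ring

lemma jacobiOffDiag_isBigO (hμ : -1 < μ) (hν : -1 < ν) :
    (fun n : ℕ => jacobiOffDiag μ ν n - 1 / 2) =O[atTop] fun n : ℕ => 1 / (n : ℝ) ^ 2 := by
  refine IsBigO.trans (IsBigO.of_bound 2 (Eventually.of_forall fun n => ?_))
    (jacobiOffDiag_sq_isBigO hμ hν)
  have h := jacobiOffDiag_pos hμ hν n
  rw [show jacobiOffDiag μ ν n ^ 2 - 1 / 4 =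
    (jacobiOffDiag μ ν n - 1 / 2) * (jacobiOffDiag μ ν n + 1 / 2) by ring, norm_mul,
    Real.norm_of_nonneg (show 0 ≤ jacobiOffDiag μ ν n + 1 / 2 by linarith)]
  nlinarith [norm_nonneg (jacobiOffDiag μ ν n - 1 / 2)]

end Asymptotics

/-! ### Orthonormal polynomials and their values at the origin -/

section Polynomials

lemma eval_H_one (hμ : -1 < μ) (hν : -1 < ν) (t : ℝ) :
    upCoeff μ ν 0 * (H μ ν α θ 1).eval t =
      Real.cos θ - (t * (Real.sin θ * quad μ ν α 0) + diagCoeff μ ν 0) := by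
  simp [H, (upCoeff_pos hμ hν 0).ne']

lemma eval_H_succ_succ (hμ : -1 < μ) (hν : -1 < ν) (n : ℕ) (t : ℝ) :
    upCoeff μ ν (n + 1) * (H μ ν α θ (n + 2)).eval t =
      (Real.cos θ - (t * (Real.sin θ * quad μ ν α (n + 1 : ℕ)) + diagCoeff μ ν (n + 1)))
        * (H μ ν α θ (n + 1)).eval t - downCoeff μ ν (n + 1) * (H μ ν α θ n).eval t := by
  simp [H, (upCoeff_pos hμ hν (n + 1)).ne']

lemma degree_linear_factor {u s c d : ℝ} (hu : u ≠ 0) (hs : s ≠ 0) :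
    (Polynomial.C u * (Polynomial.C c - (Polynomial.X * Polynomial.C s + Polynomial.C d))).degree
      = 1 := by
  have h : Polynomial.C u * (Polynomial.C c - (Polynomial.X * Polynomial.C s + Polynomial.C d))
      = Polynomial.C (-(u * s)) * Polynomial.X + Polynomial.C (u * (c - d)) := by
    simp only [map_neg, map_mul, map_sub]
    ring
  rw [h, Polynomial.degree_linear (neg_ne_zero.mpr (mul_ne_zero hu hs))]

lemma degree_H (hμ : -1 < μ) (hν : -1 < ν) (hθ : Real.sin θ ≠ 0)
    (hα : 0 < ((μ + ν + 1) / 2) ^ 2 + α) (n : ℕ) : (H μ ν α θ n).degree = n := by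
  have hu : ∀ n, (upCoeff μ ν n)⁻¹ ≠ 0 := fun n => inv_ne_zero (upCoeff_pos hμ hν n).ne'
  have hs : ∀ n : ℕ, Real.sin θ * quad μ ν α n ≠ 0 := fun n =>
    mul_ne_zero hθ (quad_pos hμ hν hα n).ne'
  induction n using Nat.twoStepInduction with
  | zero => simp [H]
  | one =>
    rw [H, degree_linear_factor (hu 0) (by simpa using hs 0)]
    rfl
  | more n ih1 ih2 =>
    have hl : (Polynomial.C (upCoeff μ ν (n + 1))⁻¹ *
        (Polynomial.C (Real.cos θ) - (Polynomial.X *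
          Polynomial.C (Real.sin θ * quad μ ν α ((n + 1 : ℕ) : ℝ))
            + Polynomial.C (diagCoeff μ ν (n + 1)))) * H μ ν α θ (n + 1)).degree
        = ((n + 2 : ℕ) : WithBot ℕ) := by
      rw [Polynomial.degree_mul, degree_linear_factor (hu (n + 1)) (hs (n + 1)), ih2, add_comm]
      rfl
    rw [H, mul_sub, ← mul_assoc, ← mul_assoc, ← map_mul, Polynomial.degree_sub_eq_left_of_degree_lt,
      hl]
    rw [hl]
    rw [Polynomial.degree_C_mul (mul_ne_zero (hu _) (downCoeff_succ_pos hμ hν n).ne'), ih1]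
    exact_mod_cast Nat.lt_add_of_pos_right two_pos

/-- The normalization making `scale n • H n` the orthonormal polynomials. -/
def scale (μ ν α θ : ℝ) : ℕ → ℝ
  | 0 => 1
  | n + 1 => -(scale μ ν α θ n * upCoeff μ ν n / (Real.sin θ * quad μ ν α n * a μ ν α θ (n + 1)))

lemma scale_ne_zero (hμ : -1 < μ) (hν : -1 < ν) (hθ : 0 < Real.sin θ)
    (hα : 0 < ((μ + ν + 1) / 2) ^ 2 + α) (n : ℕ) : scale μ ν α θ n ≠ 0 := by
  induction n with
  | zero => exact one_ne_zero
  | succ n ih =>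
    have h1 := (upCoeff_pos hμ hν n).ne'
    have h2 := (quad_pos hμ hν hα n).ne'
    have h3 := (a_succ_pos hμ hν hθ hα n).ne'
    rw [scale, neg_ne_zero]
    exact div_ne_zero (mul_ne_zero ih h1) (mul_ne_zero (mul_ne_zero hθ.ne' h2) h3)

/-- Solving the recurrence for z H_n makes both neighbour coefficients negative; the alternating
sign of `scale` makes the off-diagonal entries positive. This handles H_{n+1}; `a_mul_scale` handles
H_{n-1} and is where the value of a_n² enters. -/
lemma a_mul_scale_succ (hμ : -1 < μ) (hν : -1 < ν) (hθ : 0 < Real.sin θ)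
    (hα : 0 < ((μ + ν + 1) / 2) ^ 2 + α) (n : ℕ) : a μ ν α θ (n + 1) * scale μ ν α θ (n + 1) =
    -(scale μ ν α θ n * upCoeff μ ν n / (Real.sin θ * quad μ ν α n)) := by
  have h2 := (quad_pos hμ hν hα n).ne'
  have h3 := (a_succ_pos hμ hν hθ hα n).ne'
  rw [scale]
  field_simp

lemma a_mul_scale (hμ : -1 < μ) (hν : -1 < ν) (hθ : 0 < Real.sin θ)
    (hα : 0 < ((μ + ν + 1) / 2) ^ 2 + α) (n : ℕ) : a μ ν α θ (n + 1) * scale μ ν α θ n =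
    -(scale μ ν α θ (n + 1) * downCoeff μ ν (n + 1) / (Real.sin θ * quad μ ν α (n + 1 : ℕ))) := by
  have h2 := (quad_pos hμ hν hα n).ne'
  have h2' := (quad_pos hμ hν hα (n + 1)).ne'
  have h3 := (a_succ_pos hμ hν hθ hα n).ne'
  have h4 := a_succ_sq hμ hν hθ hα n
  rw [eq_div_iff (mul_ne_zero (mul_ne_zero (pow_ne_zero 2 hθ.ne') h2) h2')] at h4
  rw [scale]
  field_simp
  linear_combination scale μ ν α θ n * h4

lemma orthonormal_recurrence_zero (hμ : -1 < μ) (hν : -1 < ν) (hθ : 0 < Real.sin θ)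
    (hα : 0 < ((μ + ν + 1) / 2) ^ 2 + α) (t : ℝ) :
    t * (scale μ ν α θ 0 * (H μ ν α θ 0).eval t) =
      b μ ν α θ 0 * (scale μ ν α θ 0 * (H μ ν α θ 0).eval t)
      + a μ ν α θ 1 * (scale μ ν α θ 1 * (H μ ν α θ 1).eval t) := by
  have h1 := a_mul_scale_succ hμ hν hθ hα 0
  have h2 : quad μ ν α ((0 : ℕ) : ℝ) ≠ 0 := (quad_pos hμ hν hα 0).ne'
  have h3 := eval_H_one (α := α) (θ := θ) hμ hν t
  rw [← mul_assoc (a μ ν α θ 1), h1, b]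
  rw [Nat.cast_zero] at h2 ⊢
  rw [show H μ ν α θ 0 = 1 from rfl, show scale μ ν α θ 0 = 1 from rfl, Polynomial.eval_one]
  field_simp
  linear_combination h3

lemma orthonormal_recurrence_succ (hμ : -1 < μ) (hν : -1 < ν) (hθ : 0 < Real.sin θ)
    (hα : 0 < ((μ + ν + 1) / 2) ^ 2 + α) (t : ℝ) (n : ℕ) :
    t * (scale μ ν α θ (n + 1) * (H μ ν α θ (n + 1)).eval t) =
      b μ ν α θ (n + 1) * (scale μ ν α θ (n + 1) * (H μ ν α θ (n + 1)).eval t)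
      + a μ ν α θ (n + 2) * (scale μ ν α θ (n + 2) * (H μ ν α θ (n + 2)).eval t)
      + a μ ν α θ (n + 1) * (scale μ ν α θ n * (H μ ν α θ n).eval t) := by
  have h1 := a_mul_scale_succ hμ hν hθ hα (n + 1)
  have h1' := a_mul_scale hμ hν hθ hα n
  have h2 := (quad_pos hμ hν hα (n + 1)).ne'
  have h3 := eval_H_succ_succ (α := α) (θ := θ) hμ hν n t
  rw [← mul_assoc (a μ ν α θ (n + 2)), h1, ← mul_assoc (a μ ν α θ (n + 1)), h1', b]
  field_simp
  linear_combination scale μ ν α θ (n + 1) * h3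

/-- The off-diagonal part of the factorization of J through the Jacobi recurrence at cos θ. -/
lemma a_succ_eq (hμ : -1 < μ) (hν : -1 < ν) (hθ : 0 < Real.sin θ)
    (hα : 0 < ((μ + ν + 1) / 2) ^ 2 + α) (n : ℕ) : a μ ν α θ (n + 1) = jacobiOffDiag μ ν n /
    (Real.sin θ * Real.sqrt (quad μ ν α n) * Real.sqrt (quad μ ν α (n + 1 : ℕ))) := by
  have h1 := quad_pos hμ hν hα n
  have h2 := quad_pos hμ hν hα (n + 1)
  have h3 := jacobiOffDiag_pos hμ hν n
  refine (sq_eq_sq₀ (a_succ_pos hμ hν hθ hα n).le (by positivity)).mp ?_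
  rw [a_succ_sq hμ hν hθ hα, div_pow, mul_pow, mul_pow, Real.sq_sqrt h1.le, Real.sq_sqrt h2.le,
    jacobiOffDiag_sq hμ hν]

/-- The orthonormal polynomials do not tend to zero at the origin, where they are rescaled Jacobi
polynomials evaluated at `cos θ`. -/
lemma not_tendsto_orthonormal_eval_zero (hμ : -1 < μ) (hν : -1 < ν) (hθ : 0 < Real.sin θ)
    (hα : 0 < ((μ + ν + 1) / 2) ^ 2 + α) :
    ¬ Tendsto (fun n => scale μ ν α θ n * (H μ ν α θ n).eval 0) atTop (𝓝 0) := by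
  intro hlim
  set P : ℕ → ℝ := fun n => scale μ ν α θ n * (H μ ν α θ n).eval 0 with hP
  have hq : ∀ n : ℕ, 0 < Real.sqrt (quad μ ν α n) := fun n =>
    Real.sqrt_pos.mpr (quad_pos hμ hν hα n)
  have hcos : |Real.cos θ| < 1 := by
    rw [← sq_lt_one_iff_abs_lt_one]
    nlinarith [Real.sin_sq_add_cos_sq θ]
  refine not_tendsto_of_elliptic_recurrence (c := Real.cos θ)
    (φ := fun n => P n / Real.sqrt (quad μ ν α n)) (β := jacobiOffDiag μ ν)
    (d := fun n => diagCoeff μ ν n) hcos ?_ (fun n => (jacobiOffDiag_pos hμ hν n).ne') ?_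
    (tendsto_mul_abs_of_isBigO (jacobiOffDiag_isBigO hμ hν))
    (tendsto_mul_abs_of_isBigO (diagCoeff_isBigO μ ν)) ?_
  · exact div_ne_zero (by simp [hP, scale, H]) (hq 0).ne'
  · intro n
    have h := orthonormal_recurrence_succ hμ hν hθ hα 0 n
    rw [zero_mul, a_succ_eq hμ hν hθ hα n, a_succ_eq hμ hν hθ hα (n + 1), b] at h
    change 0 = _ * P (n + 1) + _ * P (n + 2) + _ * P n at h
    have h1 := hq n
    have h2 := hq (n + 1)
    have h3 := hq (n + 2)
    have h4 := Real.sq_sqrt (quad_pos hμ hν hα (n + 1)).le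
    rw [← h4] at h
    rw [show n + 1 + 1 = n + 2 from rfl] at h
    simp only [Real.sqrt_sq h2.le] at h
    have h5 := congrArg (fun y => Real.sin θ * Real.sqrt (quad μ ν α ((n + 1 : ℕ) : ℝ)) * y) h
    simp only [mul_zero] at h5
    rw [h5]
    field_simp
  -- Since `quad` · φ² = P² and n = O(`quad`), P → 0 would give n φ² → 0.
  · have h1 : (fun n : ℕ => (n : ℝ)) =O[atTop] fun n : ℕ => quad μ ν α n := by
      have h := (isEquivalent_quad μ ν α 0).symm.isBigO
      simp only [add_zero] at h
      refine IsBigO.trans (IsBigO.of_bound 1 ?_) h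
      filter_upwards [eventually_ge_atTop 1] with n hn
      have : (1 : ℝ) ≤ n := by exact_mod_cast hn
      rw [norm_pow, Real.norm_natCast, one_mul]
      nlinarith
    have h2 : Tendsto (fun n => P n ^ 2) atTop (𝓝 0) := by simpa using hlim.pow 2
    refine IsBigO.trans_tendsto ((h1.mul (isBigO_refl (fun n : ℕ =>
      (P n / Real.sqrt (quad μ ν α n)) ^ 2) atTop))) (h2.congr fun n => ?_)
    rw [div_pow, Real.sq_sqrt (quad_pos hμ hν hα n).le,
      mul_div_cancel₀ _ (quad_pos hμ hν hα n).ne']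

end Polynomials

/-! ### The Jacobi operator of the family and the main theorem -/

lemma hasMatrix_tridiag (hA : Summable fun n => |a μ ν α θ (n + 1)|)
    (hb : Summable fun n => |b μ ν α θ n|) :
    HasMatrix (EllTwo.tridiag (fun n => a μ ν α θ (n + 1)) (b μ ν α θ))
      (jacobiMatrix μ ν α θ) := by
  intro i j
  change (EllTwo.tridiag _ _ (EllTwo.e j) : EllTwo) i = _
  cases i with
  | zero =>
    rw [EllTwo.tridiag_apply_zero hA hb, EllTwo.e_apply, EllTwo.e_apply, jacobiMatrix]
    clear hA hb
    split_ifs <;> first | contradiction | omega | (subst_vars; simp)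
  | succ i =>
    rw [EllTwo.tridiag_apply_succ hA hb, EllTwo.e_apply, EllTwo.e_apply, EllTwo.e_apply,
      jacobiMatrix]
    clear hA hb
    split_ifs <;> first | contradiction | omega | (subst_vars; simp)

end FirstFamily

end

theorem mainTheorem2 (μ ν α θ : ℝ) (hμ : -1 < μ) (hν : -1 < ν)
    (hθ₀ : 0 < θ) (hθπ : θ < Real.pi) :
    ((fun n : ℕ => FirstFamily.aSq μ ν α θ n) =O[atTop] fun n : ℕ => 1 / (n : ℝ) ^ 4) ∧
    ((fun n : ℕ => FirstFamily.b μ ν α θ n) =O[atTop] fun n : ℕ => 1 / (n : ℝ) ^ 2) ∧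
    (0 < ((μ + ν + 1) / 2) ^ 2 + α →
      ∃ J : EllTwo →L[ℂ] EllTwo,
        HasMatrix J (FirstFamily.jacobiMatrix μ ν α θ) ∧
        IsCompactOperator J ∧
        IsTraceClass J ∧
        ∃ x : ℕ → ℝ,
          Function.Injective x ∧
          (∀ k, x k ≠ 0) ∧
          spectrum ℂ J = insert 0 (Set.range fun k => (x k : ℂ)) ∧
          {z : ℂ | AccPt z (𝓟 (spectrum ℂ J))} = {0} ∧
          Tendsto x atTop (𝓝 0) ∧
          (Summable fun k => |x k|) ∧
          ∃ m : Measure ℝ,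
            IsOrthogonalityMeasure (FirstFamily.H μ ν α θ) m ∧
            (∀ m' : Measure ℝ, IsOrthogonalityMeasure (FirstFamily.H μ ν α θ) m' → m' = m) ∧
            (∀ k, 0 < m {x k}) ∧
            m = Measure.sum fun k => m {x k} • Measure.dirac (x k)) := by
  refine ⟨FirstFamily.aSq_isBigO μ ν α θ, FirstFamily.b_isBigO μ ν α θ, fun hα => ?_⟩
  have hθ : 0 < Real.sin θ := Real.sin_pos_of_pos_of_lt_pi hθ₀ hθπ
  -- `tridiag` numbers its off-diagonal from 0, the matrix from 1.
  have hA : Summable fun n => |FirstFamily.a μ ν α θ (n + 1)| :=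
    (summable_nat_add_iff 1).mpr
      (FirstFamily.summable_of_isBigO_one_div_sq (FirstFamily.a_isBigO μ ν α θ))
  have hb := FirstFamily.summable_of_isBigO_one_div_sq (FirstFamily.b_isBigO μ ν α θ)
  exact ⟨_, FirstFamily.hasMatrix_tridiag hA hb,
    EllTwo.spectral_tridiag hA hb (fun n => (FirstFamily.a_succ_pos hμ hν hθ hα n).ne') rfl
      (FirstFamily.degree_H hμ hν hθ.ne' hα) rfl (FirstFamily.scale_ne_zero hμ hν hθ hα)
      (FirstFamily.orthonormal_recurrence_zero hμ hν hθ hα)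
      (FirstFamily.orthonormal_recurrence_succ hμ hν hθ hα)
      (FirstFamily.not_tendsto_orthonormal_eval_zero hμ hν hθ hα)⟩
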